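/- Let $(M_1,g_1)$ and $(M_2,g_2)$ be smooth pseudo-Riemannian manifolds (without boundary) of dimensions $n_1,n_2\ge 1$, let $f\colon M_1\to(0,\infty)$ be smooth, and let $M=M_1\times_f M_2$ be the warped product, that is, the manifold $M_1\times M_2$ of dimension $n=n_1+n_2$ with the metric $g=\pi_1^*g_1+(f\circ\pi_1)^2\,\pi_2^*g_2$. For a pseudo-Riemannian manifold $(N,h)$ of dimension $m$ with Levi-Civita connection $\nabla$ put $\mathcal R(X,Y)Z=\nabla_Y\nabla_XZ-\nabla_X\nabla_YZ+\nabla_{[X,Y]}Z$, $\mathrm{Ric}(Y,Z)=\operatorname{trace}\big(V\mapsto\mathcal R(Y,V)Z\big)$ and $\tau=\operatorname{trace}_h\mathrm{Ric}$. The concircular curvature tensor of $h$ is $$\mathcal C(X,Y)Z=\mathcal R(X,Y)Z-\frac{\tau}{m(m-1)}\big[h(X,Z)Y-h(Y,Z)X\big]$$ (with $\mathcal C=0$ if $m=1$), and it is called divergence free if $\operatorname{trace}\big(V\mapsto(\nabla_V\mathcal C)(X,Y)Z\big)=0$ for all $X,Y,Z$. Let $\mathcal C,\mathcal C^1,\mathcal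 C^2$ denote the concircular curvature tensors of $g,g_1,g_2$, let $\mathrm{grad}f$ be the gradient of $f$ on $(M_1,g_1)$ and $H^f(Y,Z)=g_1(\nabla^1_Y\,\mathrm{grad}f,Z)$ its Hessian. $(M_2,g_2)$ is called Einstein with factor $\mu\in\mathbb R$ if $\mathrm{Ric}^2=(n_2-1)\,\mu\,g_2$, so that a space of constant sectional curvature $\mu$ is Einstein with factor $\mu$. Theorem. Assume $n_1\neq 2$. Then $\mathcal C$ is divergence free in each of the following two cases: 1. $n_2\neq 2$, $f$ is constant, and both $\mathcal C^1$ and $\mathcal C^2$ are divergence free; 2. $H^f=0$, $\mathcal C^1$ is divergence free, and, for every $p\in M_1$, $(M_2,g_2)$ is Einstein with factor $g_1(\mathrm{grad}f,\mathrm{grad}f)(p)$. -/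

import Mathlib

open scoped Manifold ContDiff

set_option maxSynthPendingDepth 3

noncomputable section

/-! ### Tensor calculus of a metric on an open part of a vector space

`G : E → E →L[ℝ] E →L[ℝ] ℝ` is a field of bilinear forms (a metric written in a chart), and tensors
at a point are multilinear maps on `E`; vectors of `E` are also regarded as constant vector fields,
whose Lie brackets vanish. -/

namespace LocalMetric

variable {E : Type*} [NormedAddCommGroup E] [NormedSpace ℝ E]

/-- The Christoffel symbols of the first kind:
`(X, Y, Z) ↦ 1/2 (X G(Y, Z) + Y G(X, Z) - Z G(X, Y))` for constant fields `X, Y, Z`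
(see `christoffelLower_apply`). -/
def christoffelLower (G : E → E →L[ℝ] E →L[ℝ] ℝ) (y : E) : E →L[ℝ] E →L[ℝ] E →L[ℝ] ℝ :=
  let D : E →L[ℝ] E →L[ℝ] E →L[ℝ] ℝ := fderiv ℝ G y
  (2⁻¹ : ℝ) • (D + D.flip -
    (ContinuousLinearMap.flipₗᵢ ℝ E E ℝ).toContinuousLinearEquiv.toContinuousLinearMap ∘L D.flip)

theorem christoffelLower_apply (G : E → E →L[ℝ] E →L[ℝ] ℝ) (y X Y Z : E) :
    christoffelLower G y X Y Z =
      2⁻¹ * (fderiv ℝ G y X Y Z + fderiv ℝ G y Y X Z - fderiv ℝ G y Z X Y) := by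
  simp [christoffelLower]

/-- Raising an index: the vector `v` with `G y v = φ` (if `G y` is nondegenerate). -/
def sharp (G : E → E →L[ℝ] E →L[ℝ] ℝ) (y : E) : (E →L[ℝ] ℝ) →L[ℝ] E :=
  (G y).inverse

/-- The Christoffel symbols (of the second kind) `Γ(X, Y)` of the Levi-Civita connection. -/
def christoffel (G : E → E →L[ℝ] E →L[ℝ] ℝ) (y : E) : E →L[ℝ] E →L[ℝ] E :=
  (ContinuousLinearMap.compL ℝ E (E →L[ℝ] ℝ) E (sharp G y)) ∘L christoffelLower G y

theorem christoffel_apply (G : E → E →L[ℝ] E →L[ℝ] ℝ) (y X Y : E) :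
    christoffel G y X Y = sharp G y (christoffelLower G y X Y) := by
  simp [christoffel]

/-- The Levi-Civita covariant derivative `(∇_u Y)(y)` of a vector field `Y` in the direction `u`. -/
def covDeriv (G : E → E →L[ℝ] E →L[ℝ] ℝ) (u : E) (Y : E → E) (y : E) : E :=
  fderiv ℝ Y y u + christoffel G y u (Y y)

/-- The Riemann curvature tensor
`R(X, Y) Z = ∇_Y ∇_X Z - ∇_X ∇_Y Z + ∇_[X, Y] Z`, written out for constant fields `X, Y, Z`. -/
def riemann (G : E → E →L[ℝ] E →L[ℝ] ℝ) (y : E) : E →ₗ[ℝ] E →ₗ[ℝ] E →ₗ[ℝ] E :=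
  LinearMap.mk₂ ℝ
    (fun X Y =>
      ((fderiv ℝ (christoffel G) y Y X + christoffel G y Y ∘L christoffel G y X
        - (fderiv ℝ (christoffel G) y X Y + christoffel G y X ∘L christoffel G y Y) :
          E →L[ℝ] E) : E →ₗ[ℝ] E))
    (by intros; ext; simp; abel)
    (by intros; ext; simp [smul_sub])
    (by intros; ext; simp; abel)
    (by intros; ext; simp [smul_sub])

/-- `riemann` is the commutator of covariant derivatives, in the sign convention
`R(X, Y) Z = ∇_Y ∇_X Z - ∇_X ∇_Y Z` for commuting `X`, `Y`. -/
theorem riemann_eq_covDeriv (G : E → E →L[ℝ] E →L[ℝ] ℝ) (y X Y Z : E)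
    (h : DifferentiableAt ℝ (christoffel G) y) :
    riemann G y X Y Z =
      covDeriv G Y (covDeriv G X (fun _ => Z)) y - covDeriv G X (covDeriv G Y (fun _ => Z)) y := by
  have key : ∀ U V : E, fderiv ℝ (fun z => christoffel G z U Z) y V
      = fderiv ℝ (christoffel G) y V U Z := by
    intro U V
    have h1 : HasFDerivAt (fun z => christoffel G z U)
        ((fderiv ℝ (christoffel G) y).flip U) y := by
      simpa using h.hasFDerivAt.clm_apply (hasFDerivAt_const U y)
    have h2 : HasFDerivAt (fun z => christoffel G z U Z)
        (((fderiv ℝ (christoffel G) y).flip U).flip Z) y := by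
      simpa using h1.clm_apply (hasFDerivAt_const Z y)
    rw [h2.fderiv]; rfl
  have e : ∀ U : E, covDeriv G U (fun _ => Z) = fun z => christoffel G z U Z := by
    intro U; funext z; simp [covDeriv]
  simp only [e]
  simp [covDeriv, riemann, key]

variable [FiniteDimensional ℝ E]

/-- The Ricci tensor `Ric(Y, Z) = trace (V ↦ R(Y, V) Z)`; it is positive on round spheres. -/
def ricci (G : E → E →L[ℝ] E →L[ℝ] ℝ) (y : E) : E →ₗ[ℝ] E →ₗ[ℝ] ℝ :=
  LinearMap.mk₂ ℝ (fun Y Z => LinearMap.trace ℝ E ((riemann G y Y).flip Z))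
    (by
      intro a b c
      rw [← map_add]; congr 1; ext; simp)
    (by
      intro r a c
      rw [← map_smul]; congr 1; ext; simp)
    (by intros; simp)
    (by intros; simp)

/-- The scalar curvature: the metric trace of the Ricci tensor. -/
def scalarCurvature (G : E → E →L[ℝ] E →L[ℝ] ℝ) (y : E) : ℝ :=
  LinearMap.trace ℝ E ((sharp G y : (E →L[ℝ] ℝ) →ₗ[ℝ] E) ∘ₗ
    (LinearMap.toContinuousLinearMap : (E →ₗ[ℝ] ℝ) ≃ₗ[ℝ] (E →L[ℝ] ℝ)).toLinearMap ∘ₗ ricci G y)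

/-- The concircular curvature tensor, with `n = dim E`:
`C(X, Y) Z = R(X, Y) Z - τ / (n (n - 1)) (G(X, Z) Y - G(Y, Z) X)`.
(If `n = 1`, then the bracket vanishes and `C = 0`.) -/
def concircular (G : E → E →L[ℝ] E →L[ℝ] ℝ) (y : E) : E →ₗ[ℝ] E →ₗ[ℝ] E →ₗ[ℝ] E :=
  LinearMap.mk₂ ℝ
    (fun X Y => riemann G y X Y
      - (scalarCurvature G y / ((Module.finrank ℝ E : ℝ) * ((Module.finrank ℝ E : ℝ) - 1))) •
        ((((G y X).smulRight Y - (G y Y).smulRight X : E →L[ℝ] E)) : E →ₗ[ℝ] E))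
    (by intros; ext; simp [smul_sub, smul_add, add_smul]; abel)
    (by intros; ext; simp [smul_sub, smul_smul]; ring_nf)
    (by intros; ext; simp [smul_sub, smul_add, add_smul]; abel)
    (by intros; ext; simp [smul_sub, smul_smul]; ring_nf)

theorem concircular_apply (G : E → E →L[ℝ] E →L[ℝ] ℝ) (y X Y Z : E) :
    concircular G y X Y Z = riemann G y X Y Z
      - (scalarCurvature G y / ((Module.finrank ℝ E : ℝ) * ((Module.finrank ℝ E : ℝ) - 1))) •
        (G y X Z • Y - G y Y Z • X) := by
  simp [concircular]

/-- The covariant derivative `V ↦ (∇_V C)(X, Y) Z` of the concircular curvature tensor. -/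
def covDerivConcircular (G : E → E →L[ℝ] E →L[ℝ] ℝ) (y X Y Z : E) : E →ₗ[ℝ] E where
  toFun V := fderiv ℝ (fun z => concircular G z X Y Z) y V
    + christoffel G y V (concircular G y X Y Z)
    - concircular G y (christoffel G y V X) Y Z
    - concircular G y X (christoffel G y V Y) Z
    - concircular G y X Y (christoffel G y V Z)
  map_add' := by intros; simp; abel
  map_smul' := by intros; simp [smul_sub, smul_add]

/-- The divergence of the concircular curvature tensor:
`(div C)(X, Y, Z) = trace (V ↦ (∇_V C)(X, Y) Z)`. -/
def divConcircular (G : E → E →L[ℝ] E →L[ℝ] ℝ) (y X Y Z : E) : ℝ :=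
  LinearMap.trace ℝ E (covDerivConcircular G y X Y Z)

end LocalMetric

/-! ### Pseudo-Riemannian manifolds -/

section Manifold

variable {E : Type*} [NormedAddCommGroup E] [NormedSpace ℝ E]
  {H : Type*} [TopologicalSpace H] (I : ModelWithCorners ℝ E H)
  {M : Type*} [TopologicalSpace M] [ChartedSpace H M]

/-- The derivative `E → T_x M`, `x = φ⁻¹ y`, of the inverse of the chart `φ = e.extend I`. -/
def chartInvDeriv (e : OpenPartialHomeomorph M H) (y : E) :
    E →L[ℝ] TangentSpace I ((e.extend I).symm y) :=
  mfderiv 𝓘(ℝ, E) I (e.extend I).symm y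

/-- A field of bilinear forms on the tangent spaces, written in the chart `e` (pull-back along the
inverse of the chart). -/
def bilinInChart (val : ∀ x : M, TangentSpace I x →L[ℝ] TangentSpace I x →L[ℝ] ℝ)
    (e : OpenPartialHomeomorph M H) (y : E) : E →L[ℝ] E →L[ℝ] ℝ :=
  ContinuousLinearMap.bilinearComp (E := E) (F := E) (val ((e.extend I).symm y))
    (chartInvDeriv I e y) (chartInvDeriv I e y)

variable (M)

/-- A smooth pseudo-Riemannian metric on `M`: a symmetric nondegenerate bilinear form on every
tangent space, whose expression in every chart of the atlas is smooth. -/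
structure PseudoRiemannianMetric where
  /-- The bilinear form on the tangent space at `x`. -/
  val (x : M) : TangentSpace I x →L[ℝ] TangentSpace I x →L[ℝ] ℝ
  symm (x : M) (v w : TangentSpace I x) : val x v w = val x w v
  nondegenerate (x : M) (v : TangentSpace I x) (hv : ∀ w, val x v w = 0) : v = 0
  smooth (e : OpenPartialHomeomorph M H) (he : e ∈ atlas H M) :
    ContDiffOn ℝ ∞ (bilinInChart I val e) (e.extend I).target

variable {I M}

namespace PseudoRiemannianMetric

variable (g : PseudoRiemannianMetric I M)

/-- The metric in a chart. -/
def inChart (e : OpenPartialHomeomorph M H) : E → E →L[ℝ] E →L[ℝ] ℝ :=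
  bilinInChart I g.val e

/-- The gradient of a function: `g (grad f, w) = df w`. -/
def gradient (f : M → ℝ) (x : M) : TangentSpace I x :=
  (g.val x).inverse (mfderiv I 𝓘(ℝ, ℝ) f x)

/-- A vector field on `M`, written in the chart `e`. -/
def vectorFieldInChart (X : ∀ x : M, TangentSpace I x) (e : OpenPartialHomeomorph M H) (y : E) :
    E :=
  mfderiv I 𝓘(ℝ, E) (e.extend I) ((e.extend I).symm y) (X ((e.extend I).symm y))

/-- `H^f = 0`, where `H^f (Y, Z) = g (∇_Y grad f, Z)` is the Hessian of `f` (computed in the charts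
of the atlas; the condition does not depend on the chart). -/
def HessianEqZero (f : M → ℝ) : Prop :=
  ∀ e ∈ atlas H M, ∀ y ∈ (e.extend I).target, ∀ Y Z : E,
    g.inChart e y
      (LocalMetric.covDeriv (g.inChart e) Y (vectorFieldInChart (g.gradient f) e) y) Z = 0

variable [FiniteDimensional ℝ E]

/-- The concircular curvature tensor of `g` is divergence free (computed in the charts of the
atlas; the condition does not depend on the chart). -/
def ConcircularDivergenceFree : Prop :=
  ∀ e ∈ atlas H M, ∀ y ∈ (e.extend I).target, ∀ X Y Z : E,
    LocalMetric.divConcircular (g.inChart e) y X Y Z = 0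

/-- `(M, g)` is Einstein with factor `μ`: `Ric = (n - 1) μ g`, `n = dim M`. The factor is
normalized so that a space of constant sectional curvature `μ` is Einstein with factor `μ`. -/
def IsEinsteinWithFactor (μ : ℝ) : Prop :=
  ∀ e ∈ atlas H M, ∀ y ∈ (e.extend I).target, ∀ Y Z : E,
    LocalMetric.ricci (g.inChart e) y Y Z
      = ((Module.finrank ℝ E : ℝ) - 1) * μ * g.inChart e y Y Z

end PseudoRiemannianMetric

end Manifold

/-! ### Warped products -/

section Warped

variable {E₁ : Type*} [NormedAddCommGroup E₁] [NormedSpace ℝ E₁]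
  {H₁ : Type*} [TopologicalSpace H₁] {I₁ : ModelWithCorners ℝ E₁ H₁}
  {M₁ : Type*} [TopologicalSpace M₁] [ChartedSpace H₁ M₁]
  {E₂ : Type*} [NormedAddCommGroup E₂] [NormedSpace ℝ E₂]
  {H₂ : Type*} [TopologicalSpace H₂] {I₂ : ModelWithCorners ℝ E₂ H₂}
  {M₂ : Type*} [TopologicalSpace M₂] [ChartedSpace H₂ M₂]

/-- The bilinear forms `π₁^* g₁ + (f ∘ π₁)² π₂^* g₂` on the tangent spaces of `M₁ × M₂`. -/
def warpedForm (g₁ : PseudoRiemannianMetric I₁ M₁) (g₂ : PseudoRiemannianMetric I₂ M₂)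
    (f : M₁ → ℝ) (x : M₁ × M₂) :
    TangentSpace (I₁.prod I₂) x →L[ℝ] TangentSpace (I₁.prod I₂) x →L[ℝ] ℝ :=
  ContinuousLinearMap.bilinearComp (E := E₁) (F := E₁) (E' := E₁ × E₂) (F' := E₁ × E₂)
      (g₁.val x.1)
      (mfderiv (I₁.prod I₂) I₁ Prod.fst x) (mfderiv (I₁.prod I₂) I₁ Prod.fst x)
    + (f x.1) ^ 2 •
      ContinuousLinearMap.bilinearComp (E := E₂) (F := E₂) (E' := E₁ × E₂) (F' := E₁ × E₂)
      (g₂.val x.2)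
      (mfderiv (I₁.prod I₂) I₂ Prod.snd x) (mfderiv (I₁.prod I₂) I₂ Prod.snd x)

theorem warpedForm_apply (g₁ : PseudoRiemannianMetric I₁ M₁) (g₂ : PseudoRiemannianMetric I₂ M₂)
    (f : M₁ → ℝ) (x : M₁ × M₂) (v w : TangentSpace (I₁.prod I₂) x) :
    warpedForm g₁ g₂ f x v w
      = g₁.val x.1 (mfderiv (I₁.prod I₂) I₁ Prod.fst x v) (mfderiv (I₁.prod I₂) I₁ Prod.fst x w)
        + (f x.1) ^ 2 * g₂.val x.2 (mfderiv (I₁.prod I₂) I₂ Prod.snd x v)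
          (mfderiv (I₁.prod I₂) I₂ Prod.snd x w) :=
  rfl

theorem warpedForm_eq (g₁ : PseudoRiemannianMetric I₁ M₁) (g₂ : PseudoRiemannianMetric I₂ M₂)
    (f : M₁ → ℝ) (x : M₁ × M₂) :
    warpedForm g₁ g₂ f x =
      (show (E₁ × E₂) →L[ℝ] (E₁ × E₂) →L[ℝ] ℝ from
        ContinuousLinearMap.bilinearComp (E := E₁) (F := E₁) (g₁.val x.1)
          (ContinuousLinearMap.fst ℝ E₁ E₂) (ContinuousLinearMap.fst ℝ E₁ E₂)
        + (f x.1) ^ 2 • ContinuousLinearMap.bilinearComp (E := E₂) (F := E₂) (g₂.val x.2)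
          (ContinuousLinearMap.snd ℝ E₁ E₂) (ContinuousLinearMap.snd ℝ E₁ E₂)) := by
  unfold warpedForm
  rw [mfderiv_fst, mfderiv_snd]
  rfl

theorem contMDiffAt_extend_symm {E : Type*} [NormedAddCommGroup E] [NormedSpace ℝ E]
    {H : Type*} [TopologicalSpace H] {I : ModelWithCorners ℝ E H} [I.Boundaryless]
    {M : Type*} [TopologicalSpace M] [ChartedSpace H M] [IsManifold I ∞ M]
    {e : OpenPartialHomeomorph M H} (he : e ∈ atlas H M) {y : E} (hy : y ∈ (e.extend I).target) :
    ContMDiffAt 𝓘(ℝ, E) I ∞ (e.extend I).symm y := by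
  have he' := IsManifold.subset_maximalAtlas (I := I) (n := ∞) he
  have h := contMDiffOn_extend_symm he'
  have ht : (e.extend I).target = I '' e.target := by
    rw [e.extend_target', I.image_eq]
  rw [← ht] at h
  exact h.contMDiffAt ((e.isOpen_extend_target).mem_nhds hy)

theorem contDiffOn_bilinearComp {E F W : Type*} [NormedAddCommGroup E] [NormedSpace ℝ E]
    [NormedAddCommGroup F] [NormedSpace ℝ F] [NormedAddCommGroup W] [NormedSpace ℝ W]
    {B : W → E →L[ℝ] E →L[ℝ] ℝ} {s : Set W} (hB : ContDiffOn ℝ ∞ B s) (A : F →L[ℝ] E) :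
    ContDiffOn ℝ ∞ (fun z => (B z).bilinearComp A A) s := by
  have h := ((ContinuousLinearMap.flipₗᵢ ℝ F E ℝ).toContinuousLinearEquiv.contDiff
    (n := ∞)).comp_contDiffOn (hB.clm_comp (contDiffOn_const (c := A)))
  exact ((ContinuousLinearMap.flipₗᵢ ℝ F F ℝ).toContinuousLinearEquiv.contDiff
    (n := ∞)).comp_contDiffOn (h.clm_comp (contDiffOn_const (c := A)))

theorem bilinInChart_warpedForm [IsManifold I₁ ∞ M₁] [IsManifold I₂ ∞ M₂]
    [I₁.Boundaryless] [I₂.Boundaryless]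
    (g₁ : PseudoRiemannianMetric I₁ M₁) (g₂ : PseudoRiemannianMetric I₂ M₂) (f : M₁ → ℝ)
    {e₁ : OpenPartialHomeomorph M₁ H₁} (he₁ : e₁ ∈ atlas H₁ M₁)
    {e₂ : OpenPartialHomeomorph M₂ H₂} (he₂ : e₂ ∈ atlas H₂ M₂)
    {y : E₁ × E₂} (hy₁ : y.1 ∈ (e₁.extend I₁).target) (hy₂ : y.2 ∈ (e₂.extend I₂).target) :
    bilinInChart (I₁.prod I₂) (warpedForm g₁ g₂ f) (e₁.prod e₂) y
      = (g₁.inChart e₁ y.1).bilinearComp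
          (ContinuousLinearMap.fst ℝ E₁ E₂) (ContinuousLinearMap.fst ℝ E₁ E₂)
        + (f ((e₁.extend I₁).symm y.1)) ^ 2 • (g₂.inChart e₂ y.2).bilinearComp
          (ContinuousLinearMap.snd ℝ E₁ E₂) (ContinuousLinearMap.snd ℝ E₁ E₂) := by
  have hfun : (((e₁.prod e₂).extend (I₁.prod I₂)).symm : E₁ × E₂ → M₁ × M₂)
      = Prod.map (e₁.extend I₁).symm (e₂.extend I₂).symm := by
    rw [OpenPartialHomeomorph.extend_prod]; rfl
  have h₁ : HasMFDerivAt 𝓘(ℝ, E₁ × E₂) I₁ (fun z : E₁ × E₂ => (e₁.extend I₁).symm z.1) y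
      (chartInvDeriv I₁ e₁ y.1 ∘L (ContinuousLinearMap.fst ℝ E₁ E₂)) :=
    HasMFDerivAt.comp (I' := 𝓘(ℝ, E₁)) y
      ((contMDiffAt_extend_symm he₁ hy₁).mdifferentiableAt (by simp)).hasMFDerivAt
      (hasFDerivAt_fst (p := y)).hasMFDerivAt
  have h₂ : HasMFDerivAt 𝓘(ℝ, E₁ × E₂) I₂ (fun z : E₁ × E₂ => (e₂.extend I₂).symm z.2) y
      (chartInvDeriv I₂ e₂ y.2 ∘L (ContinuousLinearMap.snd ℝ E₁ E₂)) :=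
    HasMFDerivAt.comp (I' := 𝓘(ℝ, E₂)) y
      ((contMDiffAt_extend_symm he₂ hy₂).mdifferentiableAt (by simp)).hasMFDerivAt
      (hasFDerivAt_snd (p := y)).hasMFDerivAt
  have hd : mfderiv 𝓘(ℝ, E₁ × E₂) (I₁.prod I₂)
      (Prod.map (e₁.extend I₁).symm (e₂.extend I₂).symm) y = _ := (h₁.prodMk h₂).mfderiv
  unfold bilinInChart chartInvDeriv
  rw [hfun, hd, warpedForm_eq]
  rfl

/-- The warped product metric `g = π₁^* g₁ + (f ∘ π₁)² π₂^* g₂` on `M₁ × M₂`. -/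
def warpedProduct [IsManifold I₁ ∞ M₁] [IsManifold I₂ ∞ M₂] [I₁.Boundaryless] [I₂.Boundaryless]
    (g₁ : PseudoRiemannianMetric I₁ M₁) (g₂ : PseudoRiemannianMetric I₂ M₂)
    (f : M₁ → ℝ) (hf : ContMDiff I₁ 𝓘(ℝ, ℝ) ∞ f) (hpos : ∀ p, 0 < f p) :
    PseudoRiemannianMetric (I₁.prod I₂) (M₁ × M₂) where
  val := warpedForm g₁ g₂ f
  symm x v w := by
    rw [warpedForm_apply, warpedForm_apply, g₁.symm, g₂.symm]
  nondegenerate x v hv := by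
    rw [warpedForm_eq] at hv
    have h₁ : (show E₁ × E₂ from v).1 = 0 := by
      refine g₁.nondegenerate x.1 _ fun w => ?_
      have h : g₁.val x.1 (show E₁ × E₂ from v).1 w
          + (f x.1) ^ 2 * g₂.val x.2 (show E₁ × E₂ from v).2 (0 : TangentSpace I₂ x.2) = 0 :=
        hv (show E₁ × E₂ from (w, (0 : E₂)))
      rw [map_zero, mul_zero, add_zero] at h
      exact h
    have h₂ : (show E₁ × E₂ from v).2 = 0 := by
      refine g₂.nondegenerate x.2 _ fun w => ?_
      have h : g₁.val x.1 (show E₁ × E₂ from v).1 (0 : TangentSpace I₁ x.1)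
          + (f x.1) ^ 2 * g₂.val x.2 (show E₁ × E₂ from v).2 w = 0 :=
        hv (show E₁ × E₂ from ((0 : E₁), w))
      rw [map_zero, zero_add] at h
      exact (mul_eq_zero.mp h).resolve_left (pow_ne_zero 2 (hpos x.1).ne')
    exact Prod.ext h₁ h₂
  smooth e he := by
    obtain ⟨e₁, he₁, e₂, he₂, rfl⟩ := he
    rw [OpenPartialHomeomorph.extend_prod, PartialEquiv.prod_target]
    have hF : ContDiffOn ℝ ∞ (fun z => f ((e₁.extend I₁).symm z)) (e₁.extend I₁).target := by
      intro z hz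
      exact ((hf _).comp z (contMDiffAt_extend_symm he₁ hz)).contDiffAt.contDiffWithinAt
    have hF' := hF.comp (contDiff_fst (𝕜 := ℝ) (E := E₁) (F := E₂) (n := ∞)).contDiffOn
      (s := (e₁.extend I₁).target ×ˢ (e₂.extend I₂).target) (fun z hz => hz.1)
    have h₁ := (g₁.smooth e₁ he₁).comp (contDiff_fst (𝕜 := ℝ) (E := E₁) (F := E₂)).contDiffOn
      (s := (e₁.extend I₁).target ×ˢ (e₂.extend I₂).target) (fun z hz => hz.1)
    have h₂ := (g₂.smooth e₂ he₂).comp (contDiff_snd (𝕜 := ℝ) (E := E₁) (F := E₂)).contDiffOn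
      (s := (e₁.extend I₁).target ×ˢ (e₂.extend I₂).target) (fun z hz => hz.2)
    have key : ContDiffOn ℝ ∞ (fun z : E₁ × E₂ =>
        (g₁.inChart e₁ z.1).bilinearComp
          (ContinuousLinearMap.fst ℝ E₁ E₂) (ContinuousLinearMap.fst ℝ E₁ E₂)
        + (f ((e₁.extend I₁).symm z.1)) ^ 2 • (g₂.inChart e₂ z.2).bilinearComp
          (ContinuousLinearMap.snd ℝ E₁ E₂) (ContinuousLinearMap.snd ℝ E₁ E₂))
        ((e₁.extend I₁).target ×ˢ (e₂.extend I₂).target) := by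
      refine ContDiffOn.add ?_ (ContDiffOn.smul (hF'.pow 2) ?_)
      · exact contDiffOn_bilinearComp h₁ _
      · exact contDiffOn_bilinearComp h₂ _
    exact key.congr fun z hz => bilinInChart_warpedForm g₁ g₂ f he₁ he₂ hz.1 hz.2

end Warped

end

/-! The statement is local, so the work is done in product charts. The contracted second Bianchi
identity (`div_riemann`) expresses the divergence of the concircular tensor through dτ and (∇_Y
Ric)(X, Z) - (∇_X Ric)(Y, Z). If it vanishes, one more trace, combined with 2 div Ric = dτ, gives
(1/2 - 1/n) dτ = 0. Outside dimension two, therefore, dτ = 0 and Ric is a Codazzi tensor. Conversely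
these two properties suffice in every dimension, so only the dimensions of the factors need
restricting, never n₁ + n₂.

In both cases N = grad f is parallel. The curvature of the warped product is then block diagonal
(`riemann_eq`), and Ric = Ric¹ + (Ric² - (n₂ - 1) g₁(N, N) g₂). In the first case N = 0 and Ric =
Ric¹ + Ric²; in the second the Einstein condition cancels the fibre block and Ric = Ric¹. Writing
Ric = Ric¹ + ε Ric² with ε = 1 or ε = 0 treats both together (`IsWarpingOn.divConcircular_eq_zero`).
The scalar curvature τ₁ + ε F⁻² τ₂ has zero differential. The Codazzi equation is inherited from the
factors: the extra horizontal part of the Christoffel symbols is a multiple of N, and Ric¹(·, N) = 0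
because curvature annihilates a parallel field (`riemann_parallel`). -/

namespace LocalMetric

/-! ### Levi-Civita connection, curvature symmetries and the second Bianchi identity. -/

variable {E : Type*} [NormedAddCommGroup E] [NormedSpace ℝ E]

theorem hasFDerivAt_apply {F₁ F₂ : Type*} [NormedAddCommGroup F₁] [NormedSpace ℝ F₁]
    [NormedAddCommGroup F₂] [NormedSpace ℝ F₂] {A : E → F₁ →L[ℝ] F₂} {A' : E →L[ℝ] F₁ →L[ℝ] F₂}
    {y : E} (h : HasFDerivAt A A' y) (v : F₁) : HasFDerivAt (fun z => A z v) (A'.flip v) y := by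
  simpa using h.clm_apply (hasFDerivAt_const v y)

theorem minSmoothness_two_le_infty : minSmoothness ℝ 2 ≤ ∞ := by
  rw [minSmoothness_of_isRCLikeNormedField]
  exact WithTop.coe_le_coe.2 (le_top : (2 : ℕ∞) ≤ ⊤)

theorem riemann_apply (G : E → E →L[ℝ] E →L[ℝ] ℝ) (y X Y Z : E) :
    riemann G y X Y Z = fderiv ℝ (christoffel G) y Y X Z + christoffel G y Y (christoffel G y X Z)
      - (fderiv ℝ (christoffel G) y X Y Z + christoffel G y X (christoffel G y Y Z)) := by
  simp [riemann]

theorem riemann_swap (G : E → E →L[ℝ] E →L[ℝ] ℝ) (y X Y Z : E) :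
    riemann G y X Y Z = - riemann G y Y X Z := by
  simp [riemann_apply]

/-- The field `G` of bilinear forms is a smooth pseudo-Riemannian metric on the open set `U`. -/
structure IsMetricOn (G : E → E →L[ℝ] E →L[ℝ] ℝ) (U : Set E) : Prop where
  isOpen : IsOpen U
  contDiffOn : ContDiffOn ℝ ∞ G U
  symm : ∀ y ∈ U, ∀ v w, G y v w = G y w v
  nondegenerate : ∀ y ∈ U, ∀ v, (∀ w, G y v w = 0) → v = 0

/-- The covariant derivative `(∇_V R)(X, Y) Z` of the Riemann curvature tensor. -/
noncomputable def covDerivRiemann (G : E → E →L[ℝ] E →L[ℝ] ℝ) (y V X Y Z : E) : E :=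
  fderiv ℝ (fun z => riemann G z X Y Z) y V
    + christoffel G y V (riemann G y X Y Z)
    - riemann G y (christoffel G y V X) Y Z
    - riemann G y X (christoffel G y V Y) Z
    - riemann G y X Y (christoffel G y V Z)

namespace IsMetricOn

variable {G : E → E →L[ℝ] E →L[ℝ] ℝ} {U : Set E} {y : E}

theorem ext (hG : IsMetricOn G U) (hy : y ∈ U) {v v' : E} (h : ∀ w, G y v w = G y v' w) :
    v = v' :=
  sub_eq_zero.mp <| hG.nondegenerate y hy _ fun w => by simp [h w]

theorem contDiffAt (hG : IsMetricOn G U) (hy : y ∈ U) : ContDiffAt ℝ ∞ G y :=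
  hG.contDiffOn.contDiffAt (hG.isOpen.mem_nhds hy)

theorem differentiableAt (hG : IsMetricOn G U) (hy : y ∈ U) : DifferentiableAt ℝ G y :=
  (hG.contDiffAt hy).differentiableAt (by simp)

theorem contDiffAt_christoffelLower (hG : IsMetricOn G U) (hy : y ∈ U) :
    ContDiffAt ℝ ∞ (christoffelLower G) y := by
  have hD : ContDiffAt ℝ ∞ (fderiv ℝ G) y := (hG.contDiffAt hy).fderiv_right (by simp)
  have hF : ContDiffAt ℝ ∞ (fun z => (fderiv ℝ G z).flip) y :=
    (ContinuousLinearMap.flipₗᵢ ℝ E E (E →L[ℝ] ℝ)).toContinuousLinearEquiv.contDiff.contDiffAt.comp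
      y hD
  exact ((hD.add hF).sub (contDiffAt_const.clm_comp hF)).const_smul (2⁻¹ : ℝ)

theorem fderiv_symm (hG : IsMetricOn G U) (hy : y ∈ U) (V X Y : E) :
    fderiv ℝ G y V X Y = fderiv ℝ G y V Y X := by
  have h := (hG.differentiableAt hy).hasFDerivAt
  have h1 := hasFDerivAt_apply (hasFDerivAt_apply h X) Y
  have h2 := hasFDerivAt_apply (hasFDerivAt_apply h Y) X
  have he : (fun z => G z X Y) =ᶠ[nhds y] fun z => G z Y X := by
    filter_upwards [hG.isOpen.mem_nhds hy] with z hz using hG.symm z hz X Y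
  have := h1.unique (h2.congr_of_eventuallyEq he)
  exact congrArg (fun φ : E →L[ℝ] ℝ => φ V) this

variable [FiniteDimensional ℝ E]

/-- `sharp` is built on `inverse`, which is zero on maps that are not invertible; this shows that
the default value never occurs on `U`. -/
theorem isInvertible (hG : IsMetricOn G U) (hy : y ∈ U) : (G y).IsInvertible := by
  have hinj : Function.Injective (G y : E →ₗ[ℝ] (E →L[ℝ] ℝ)) := by
    rw [← LinearMap.ker_eq_bot, LinearMap.ker_eq_bot']
    intro v hv
    exact hG.nondegenerate y hy v fun w => by
      have := congrArg (fun φ : E →L[ℝ] ℝ => φ w) hv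
      simpa using this
  have hdim : Module.finrank ℝ E = Module.finrank ℝ (E →L[ℝ] ℝ) := by
    rw [← (LinearMap.toContinuousLinearMap : (E →ₗ[ℝ] ℝ) ≃ₗ[ℝ] (E →L[ℝ] ℝ)).finrank_eq]
    exact (Subspace.dual_finrank_eq (K := ℝ) (V := E)).symm
  refine ⟨(LinearEquiv.ofInjectiveOfFinrankEq _ hinj hdim).toContinuousLinearEquiv, ?_⟩
  ext v w
  rfl

theorem apply_sharp (hG : IsMetricOn G U) (hy : y ∈ U) (φ : E →L[ℝ] ℝ) :
    G y (sharp G y φ) = φ :=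
  (hG.isInvertible hy).self_apply_inverse φ

theorem sharp_apply (hG : IsMetricOn G U) (hy : y ∈ U) (v : E) : sharp G y (G y v) = v :=
  (hG.isInvertible hy).inverse_apply_self v

theorem contDiffAt_sharp (hG : IsMetricOn G U) (hy : y ∈ U) : ContDiffAt ℝ ∞ (sharp G) y := by
  have : CompleteSpace E := FiniteDimensional.complete ℝ E
  exact (hG.isInvertible hy).contDiffAt_map_inverse.comp y (hG.contDiffAt hy)

theorem contDiffAt_christoffel (hG : IsMetricOn G U) (hy : y ∈ U) :
    ContDiffAt ℝ ∞ (christoffel G) y := by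
  refine ContDiffAt.clm_comp ?_ (hG.contDiffAt_christoffelLower hy)
  exact (ContinuousLinearMap.contDiff _).contDiffAt.comp y (hG.contDiffAt_sharp hy)

theorem apply_christoffel (hG : IsMetricOn G U) (hy : y ∈ U) (X Y Z : E) :
    G y (christoffel G y X Y) Z =
      2⁻¹ * (fderiv ℝ G y X Y Z + fderiv ℝ G y Y X Z - fderiv ℝ G y Z X Y) := by
  rw [christoffel_apply, hG.apply_sharp hy, christoffelLower_apply]

theorem christoffel_symm (hG : IsMetricOn G U) (hy : y ∈ U) (X Y : E) :
    christoffel G y X Y = christoffel G y Y X :=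
  hG.ext hy fun Z => by
    rw [hG.apply_christoffel hy, hG.apply_christoffel hy, hG.fderiv_symm hy Z X Y]; ring

/-- The Levi-Civita connection is metric. -/
theorem fderiv_apply (hG : IsMetricOn G U) (hy : y ∈ U) (V X Y : E) :
    fderiv ℝ G y V X Y = G y (christoffel G y V X) Y + G y X (christoffel G y V Y) := by
  rw [hG.symm y hy X, hG.apply_christoffel hy, hG.apply_christoffel hy, hG.fderiv_symm hy V Y X,
    hG.fderiv_symm hy X V Y, hG.fderiv_symm hy Y V X]
  ring

/-- The Levi-Civita connection is the unique symmetric metric connection. -/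
theorem christoffel_unique (hG : IsMetricOn G U) (hy : y ∈ U) {Γ : E → E → E}
    (hsymm : ∀ X Y, Γ X Y = Γ Y X)
    (hΓ : ∀ V X Y, fderiv ℝ G y V X Y = G y (Γ V X) Y + G y X (Γ V Y)) (X Y : E) :
    christoffel G y X Y = Γ X Y :=
  hG.ext hy fun Z => by
    rw [hG.apply_christoffel hy, hΓ, hΓ, hΓ, hsymm Y X, hsymm Z X, hsymm Z Y,
      hG.symm y hy Y, hG.symm y hy X]
    ring

theorem differentiableAt_christoffel (hG : IsMetricOn G U) (hy : y ∈ U) :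
    DifferentiableAt ℝ (christoffel G) y :=
  (hG.contDiffAt_christoffel hy).differentiableAt (by simp)

theorem contDiffAt_fderiv_christoffel (hG : IsMetricOn G U) (hy : y ∈ U) :
    ContDiffAt ℝ ∞ (fderiv ℝ (christoffel G)) y :=
  (hG.contDiffAt_christoffel hy).fderiv_right (by simp)

/-- The product rule applied to ∂Γ + Γ Γ for constant fields. Only the values of the derivative
matter later, so the operator itself stays hidden behind an existential. -/
theorem hasFDerivAt_riemann (hG : IsMetricOn G U) (hy : y ∈ U) (X Y Z : E) :
    ∃ L : E →L[ℝ] E, HasFDerivAt (fun z => riemann G z X Y Z) L y ∧ ∀ V, L V =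
      fderiv ℝ (fderiv ℝ (christoffel G)) y V Y X Z
        + (fderiv ℝ (christoffel G) y V Y (christoffel G y X Z)
          + christoffel G y Y (fderiv ℝ (christoffel G) y V X Z))
      - (fderiv ℝ (fderiv ℝ (christoffel G)) y V X Y Z
        + (fderiv ℝ (christoffel G) y V X (christoffel G y Y Z)
          + christoffel G y X (fderiv ℝ (christoffel G) y V Y Z))) := by
  have hΓ := (hG.differentiableAt_christoffel hy).hasFDerivAt
  have hD := ((hG.contDiffAt_fderiv_christoffel hy).differentiableAt (by simp)).hasFDerivAt
  have h1 := fun A B : E => hasFDerivAt_apply (hasFDerivAt_apply (hasFDerivAt_apply hD A) B) Z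
  have h2 := fun A B : E =>
    (hasFDerivAt_apply hΓ A).clm_apply (hasFDerivAt_apply (hasFDerivAt_apply hΓ B) Z)
  refine ⟨_, (((h1 Y X).add (h2 Y X)).sub ((h1 X Y).add (h2 X Y))).congr_of_eventuallyEq
    (.of_forall fun z => riemann_apply G z X Y Z), fun V => ?_⟩
  simp only [add_apply, sub_apply,
    ContinuousLinearMap.flip_apply, ContinuousLinearMap.comp_apply]
  abel

theorem differentiableAt_riemann (hG : IsMetricOn G U) (hy : y ∈ U) (X Y Z : E) :
    DifferentiableAt ℝ (fun z => riemann G z X Y Z) y :=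
  (hG.hasFDerivAt_riemann hy X Y Z).choose_spec.1.differentiableAt

theorem fderiv_riemann (hG : IsMetricOn G U) (hy : y ∈ U) (V X Y Z : E) :
    fderiv ℝ (fun z => riemann G z X Y Z) y V =
      fderiv ℝ (fderiv ℝ (christoffel G)) y V Y X Z
        + (fderiv ℝ (christoffel G) y V Y (christoffel G y X Z)
          + christoffel G y Y (fderiv ℝ (christoffel G) y V X Z))
      - (fderiv ℝ (fderiv ℝ (christoffel G)) y V X Y Z
        + (fderiv ℝ (christoffel G) y V X (christoffel G y Y Z)
          + christoffel G y X (fderiv ℝ (christoffel G) y V Y Z))) := by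
  obtain ⟨L, h, hL⟩ := hG.hasFDerivAt_riemann hy X Y Z
  rw [h.fderiv, hL]

theorem fderiv_fderiv_christoffel_symm (hG : IsMetricOn G U) (hy : y ∈ U) (V X : E) :
    fderiv ℝ (fderiv ℝ (christoffel G)) y V X = fderiv ℝ (fderiv ℝ (christoffel G)) y X V :=
  ((hG.contDiffAt_christoffel hy).isSymmSndFDerivAt minSmoothness_two_le_infty).eq V X

/-- The second Bianchi identity. -/
theorem bianchi_second (hG : IsMetricOn G U) (hy : y ∈ U) (V X Y Z : E) :
    covDerivRiemann G y V X Y Z + covDerivRiemann G y X Y V Z + covDerivRiemann G y Y V X Z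
      = 0 := by
  -- The second derivatives of Γ cancel because they are symmetric; since Γ is symmetric, the terms
  -- with R(Γ(V, X), Y) cancel in pairs by skew-symmetry of R. What remains cancels as in the Jacobi
  -- identity.
  simp only [covDerivRiemann, hG.fderiv_riemann hy, hG.fderiv_fderiv_christoffel_symm hy X V,
    hG.fderiv_fderiv_christoffel_symm hy Y V, hG.fderiv_fderiv_christoffel_symm hy Y X,
    hG.christoffel_symm hy X V, hG.christoffel_symm hy Y V, hG.christoffel_symm hy Y X,
    riemann_swap G y (christoffel G y V X) Y, riemann_swap G y (christoffel G y X Y) V,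
    riemann_swap G y (christoffel G y V Y) X]
  simp only [riemann_apply, map_add, map_sub]
  abel

/-- `R(X, Y)` is skew-adjoint with respect to the metric. -/
theorem riemann_skew (hG : IsMetricOn G U) (hy : y ∈ U) (X Y Z W : E) :
    G y (riemann G y X Y Z) W + G y Z (riemann G y X Y W) = 0 := by
  have hΓ := (hG.differentiableAt_christoffel hy).hasFDerivAt
  have hg := (hG.differentiableAt hy).hasFDerivAt
  have hD : DifferentiableAt ℝ (fderiv ℝ G) y :=
    ((hG.contDiffAt hy).fderiv_right (m := ∞) (by simp)).differentiableAt (by simp)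
  -- Differentiating metric compatibility computes the second derivative of G(Z, W); its symmetry in
  -- the two directions is the skew-adjointness of the curvature.
  have key : ∀ A B : E, fderiv ℝ (fderiv ℝ G) y B A Z W =
      fderiv ℝ G y B (christoffel G y A Z) W + G y (fderiv ℝ (christoffel G) y B A Z) W
      + (fderiv ℝ G y B Z (christoffel G y A W) + G y Z (fderiv ℝ (christoffel G) y B A W)) := by
    intro A B
    have h0 := hasFDerivAt_apply (hasFDerivAt_apply (hasFDerivAt_apply hD.hasFDerivAt A) Z) W
    have h1 := hasFDerivAt_apply (hg.clm_apply (hasFDerivAt_apply (hasFDerivAt_apply hΓ A) Z)) W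
    have h2 := (hasFDerivAt_apply hg Z).clm_apply (hasFDerivAt_apply (hasFDerivAt_apply hΓ A) W)
    have he : (fun z => fderiv ℝ G z A Z W) =ᶠ[nhds y] fun z =>
        G z (christoffel G z A Z) W + G z Z (christoffel G z A W) := by
      filter_upwards [hG.isOpen.mem_nhds hy] with z hz using hG.fderiv_apply hz A Z W
    have := congrArg (fun φ : E →L[ℝ] ℝ => φ B) (h0.unique ((h1.add h2).congr_of_eventuallyEq he))
    simp only [add_apply, ContinuousLinearMap.flip_apply,
      ContinuousLinearMap.comp_apply] at this
    rw [this]; ring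
  have hs : fderiv ℝ (fderiv ℝ G) y X Y = fderiv ℝ (fderiv ℝ G) y Y X :=
    ((hG.contDiffAt hy).isSymmSndFDerivAt minSmoothness_two_le_infty).eq X Y
  have h := key X Y
  rw [← hs, key Y X] at h
  simp only [hG.fderiv_apply hy] at h
  simp only [riemann_apply, map_add, map_sub, add_apply,
    sub_apply]
  linarith

/-- Differentiate `riemann_skew`: as the connection is metric, every correction term is again an
instance of that identity. -/
theorem covDerivRiemann_skew (hG : IsMetricOn G U) (hy : y ∈ U) (V X Y Z W : E) :
    G y (covDerivRiemann G y V X Y Z) W + G y Z (covDerivRiemann G y V X Y W) = 0 := by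
  have hg := (hG.differentiableAt hy).hasFDerivAt
  have h1 := hasFDerivAt_apply (hg.clm_apply (hG.differentiableAt_riemann hy X Y Z).hasFDerivAt) W
  have h2 := (hasFDerivAt_apply hg Z).clm_apply (hG.differentiableAt_riemann hy X Y W).hasFDerivAt
  have he : (fun _ => (0 : ℝ)) =ᶠ[nhds y] fun z =>
      G z (riemann G z X Y Z) W + G z Z (riemann G z X Y W) := by
    filter_upwards [hG.isOpen.mem_nhds hy] with z hz using (hG.riemann_skew hz X Y Z W).symm
  have h := congrArg (fun φ : E →L[ℝ] ℝ => φ V)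
    ((hasFDerivAt_const (0 : ℝ) y).unique ((h1.add h2).congr_of_eventuallyEq he))
  simp only [add_apply, ContinuousLinearMap.flip_apply,
    ContinuousLinearMap.comp_apply, zero_apply, hG.fderiv_apply hy] at h
  have e1 := hG.riemann_skew hy (christoffel G y V X) Y Z W
  have e2 := hG.riemann_skew hy X (christoffel G y V Y) Z W
  have e3 := hG.riemann_skew hy X Y (christoffel G y V Z) W
  have e4 := hG.riemann_skew hy X Y Z (christoffel G y V W)
  simp only [covDerivRiemann, map_add, map_sub, add_apply,
    sub_apply]
  linarith

end IsMetricOn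

end LocalMetric

/-! ### Contracted Bianchi identities and the divergence of the concircular tensor. -/

namespace LocalMetric

variable {E : Type*} [NormedAddCommGroup E] [NormedSpace ℝ E]

theorem trace_eq_sum_repr {ι : Type*} [Fintype ι] (b : Module.Basis ι ℝ E) (A : E →ₗ[ℝ] E) :
    LinearMap.trace ℝ E A = ∑ i, b.repr (A (b i)) i := by
  classical
  rw [LinearMap.trace_eq_matrix_trace ℝ b]
  simp [Matrix.trace, LinearMap.toMatrix_apply]

theorem sum_repr_comp_comm {ι : Type*} [Fintype ι] (b : Module.Basis ι ℝ E) (A B : E →ₗ[ℝ] E) :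
    ∑ i, b.repr (A (B (b i))) i = ∑ i, b.repr (B (A (b i))) i := by
  have h := LinearMap.trace_mul_comm ℝ A B
  rwa [trace_eq_sum_repr b, trace_eq_sum_repr b] at h

theorem sum_apply_mul_repr {ι : Type*} [Fintype ι] (b : Module.Basis ι ℝ E) (φ : E →ₗ[ℝ] ℝ)
    (v : E) : ∑ i, φ (b i) * b.repr v i = φ v := by
  conv_rhs => rw [← b.sum_repr v, map_sum]
  simp only [map_smul, smul_eq_mul, mul_comm]

theorem ricci_apply (G : E → E →L[ℝ] E →L[ℝ] ℝ) (y Y Z : E) :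
    ricci G y Y Z = LinearMap.trace ℝ E ((riemann G y Y).flip Z) := rfl

theorem ricci_eq_sum (G : E → E →L[ℝ] E →L[ℝ] ℝ) {ι : Type*} [Fintype ι]
    (b : Module.Basis ι ℝ E) (y Y Z : E) :
    ricci G y Y Z = ∑ i, b.repr (riemann G y Y (b i) Z) i := by
  rw [ricci_apply, trace_eq_sum_repr b]; rfl

variable [FiniteDimensional ℝ E]

/-- The covariant derivative `(∇_V Ric)(Y, Z)` of the Ricci tensor. -/
noncomputable def covDerivRicci (G : E → E →L[ℝ] E →L[ℝ] ℝ) (y V Y Z : E) : ℝ :=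
  fderiv ℝ (fun z => ricci G z Y Z) y V - ricci G y (christoffel G y V Y) Z
    - ricci G y Y (christoffel G y V Z)

/-- The Ricci operator: `G (Q Y, Z) = Ric (Y, Z)`. -/
noncomputable def ricciOperator (G : E → E →L[ℝ] E →L[ℝ] ℝ) (y : E) : E →ₗ[ℝ] E :=
  (sharp G y : (E →L[ℝ] ℝ) →ₗ[ℝ] E) ∘ₗ
    (LinearMap.toContinuousLinearMap : (E →ₗ[ℝ] ℝ) ≃ₗ[ℝ] (E →L[ℝ] ℝ)).toLinearMap ∘ₗ ricci G y

theorem scalarCurvature_eq_sum (G : E → E →L[ℝ] E →L[ℝ] ℝ) {ι : Type*} [Fintype ι]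
    (b : Module.Basis ι ℝ E) (y : E) :
    scalarCurvature G y = ∑ i, b.repr (ricciOperator G y (b i)) i :=
  trace_eq_sum_repr b (ricciOperator G y)

/-- The covariant derivative `(∇_V Q) Y` of the Ricci operator. -/
noncomputable def covDerivRicciOperator (G : E → E →L[ℝ] E →L[ℝ] ℝ) (y V Y : E) : E :=
  fderiv ℝ (fun z => ricciOperator G z Y) y V + christoffel G y V (ricciOperator G y Y)
    - ricciOperator G y (christoffel G y V Y)

/-- The coordinate functional of a basis, as a continuous linear map. -/
noncomputable def coordCLM {ι : Type*} (b : Module.Basis ι ℝ E) (i : ι) : E →L[ℝ] ℝ :=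
  LinearMap.toContinuousLinearMap (b.coord i)

@[simp] theorem coordCLM_apply {ι : Type*} (b : Module.Basis ι ℝ E) (i : ι) (v : E) :
    coordCLM b i v = b.repr v i := rfl

/-- This form displays the Ricci operator through scalar functions and index-raised fixed covectors,
from which its differentiability can be read off. -/
theorem ricciOperator_eq_sum (G : E → E →L[ℝ] E →L[ℝ] ℝ) {ι : Type*} [Fintype ι]
    (b : Module.Basis ι ℝ E) (y Y : E) :
    ricciOperator G y Y = ∑ i, ricci G y Y (b i) • sharp G y (coordCLM b i) := by
  have h : LinearMap.toContinuousLinearMap (ricci G y Y)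
      = ∑ i, ricci G y Y (b i) • coordCLM b i := by
    ext v
    simp [sum_apply_mul_repr b (ricci G y Y) v]
  calc ricciOperator G y Y = sharp G y (LinearMap.toContinuousLinearMap (ricci G y Y)) := rfl
    _ = _ := by rw [h]; simp

namespace IsMetricOn

variable {G : E → E →L[ℝ] E →L[ℝ] ℝ} {U : Set E} {y : E}

theorem hasFDerivAt_ricci (hG : IsMetricOn G U) (hy : y ∈ U) {ι : Type*} [Fintype ι]
    (b : Module.Basis ι ℝ E) (Y Z : E) :
    HasFDerivAt (fun z => ricci G z Y Z)
      (∑ i, coordCLM b i ∘L fderiv ℝ (fun z => riemann G z Y (b i) Z) y) y := by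
  simp only [ricci_eq_sum G b]
  exact HasFDerivAt.fun_sum fun i _ =>
    (coordCLM b i).hasFDerivAt.comp y (hG.differentiableAt_riemann hy Y (b i) Z).hasFDerivAt

theorem differentiableAt_ricci (hG : IsMetricOn G U) (hy : y ∈ U) (Y Z : E) :
    DifferentiableAt ℝ (fun z => ricci G z Y Z) y :=
  (hG.hasFDerivAt_ricci hy (Module.finBasis ℝ E) Y Z).differentiableAt

/-- Covariant differentiation commutes with contraction, because the commutator of Γ(V, ·) with an
endomorphism has trace zero. -/
theorem sum_repr_covDerivRiemann (hG : IsMetricOn G U) (hy : y ∈ U) {ι : Type*} [Fintype ι]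
    (b : Module.Basis ι ℝ E) (V Y Z : E) :
    ∑ i, b.repr (covDerivRiemann G y V Y (b i) Z) i = covDerivRicci G y V Y Z := by
  have hc := sum_repr_comp_comm b (christoffel G y V : E →ₗ[ℝ] E) ((riemann G y Y).flip Z)
  simp only [LinearMap.flip_apply, ContinuousLinearMap.coe_coe] at hc
  rw [covDerivRicci, (hG.hasFDerivAt_ricci hy b Y Z).fderiv]
  simp only [covDerivRiemann, ricci_eq_sum G b, map_add, map_sub, Finsupp.add_apply, Finsupp.sub_apply,
    Finset.sum_add_distrib, Finset.sum_sub_distrib, hc]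
  simp only [sum_apply, ContinuousLinearMap.comp_apply, coordCLM_apply]
  ring

/-- The contracted second Bianchi identity:
`trace (V ↦ (∇_V R)(X, Y) Z) = (∇_Y Ric)(X, Z) - (∇_X Ric)(Y, Z)`. -/
theorem div_riemann (hG : IsMetricOn G U) (hy : y ∈ U) {ι : Type*} [Fintype ι]
    (b : Module.Basis ι ℝ E) (X Y Z : E) :
    ∑ i, b.repr (covDerivRiemann G y (b i) X Y Z) i
      = covDerivRicci G y Y X Z - covDerivRicci G y X Y Z := by
  rw [← hG.sum_repr_covDerivRiemann hy b Y X, ← hG.sum_repr_covDerivRiemann hy b X Y,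
    ← Finset.sum_sub_distrib]
  refine Finset.sum_congr rfl fun i _ => ?_
  have h := hG.bianchi_second hy (b i) X Y Z
  -- Skew-symmetry brings the last Bianchi term to the index order in which its trace is a
  -- derivative of Ric.
  have hs : covDerivRiemann G y Y (b i) X Z = - covDerivRiemann G y Y X (b i) Z := by
    have e : (fun z => riemann G z (b i) X Z) = fun z => - riemann G z X (b i) Z := by
      funext z; exact riemann_swap G z _ _ _
    simp only [covDerivRiemann, e, fderiv_fun_neg, riemann_swap G y (christoffel G y Y (b i)),
      riemann_swap G y (b i)]
    simp
    abel
  rw [hs, add_neg_eq_zero] at h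
  rw [← h, map_add, Finsupp.add_apply]
  ring

theorem apply_ricciOperator (hG : IsMetricOn G U) (hy : y ∈ U) (Y Z : E) :
    G y (ricciOperator G y Y) Z = ricci G y Y Z := by
  have : ricciOperator G y Y = sharp G y (LinearMap.toContinuousLinearMap (ricci G y Y)) := rfl
  rw [this, hG.apply_sharp hy]; rfl

theorem differentiableAt_ricciOperator (hG : IsMetricOn G U) (hy : y ∈ U) (Y : E) :
    DifferentiableAt ℝ (fun z => ricciOperator G z Y) y := by
  simp only [ricciOperator_eq_sum G (Module.finBasis ℝ E)]
  refine DifferentiableAt.fun_sum fun i _ => (hG.differentiableAt_ricci hy _ _).smul ?_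
  exact (hasFDerivAt_apply ((hG.contDiffAt_sharp hy).differentiableAt (by simp)).hasFDerivAt
    _).differentiableAt

/-- Lowering an index commutes with the covariant derivative, as the metric is parallel. -/
theorem apply_covDerivRicciOperator (hG : IsMetricOn G U) (hy : y ∈ U) (V Y Z : E) :
    G y (covDerivRicciOperator G y V Y) Z = covDerivRicci G y V Y Z := by
  have h1 := hasFDerivAt_apply ((hG.differentiableAt hy).hasFDerivAt.clm_apply
    (hG.differentiableAt_ricciOperator hy Y).hasFDerivAt) Z
  have he : (fun z => ricci G z Y Z) =ᶠ[nhds y] fun z => G z (ricciOperator G z Y) Z := by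
    filter_upwards [hG.isOpen.mem_nhds hy] with z hz using (hG.apply_ricciOperator hz Y Z).symm
  simp only [covDerivRicci, (h1.congr_of_eventuallyEq he).fderiv, covDerivRicciOperator,
    ← hG.apply_ricciOperator hy, add_apply, ContinuousLinearMap.flip_apply, sub_apply, map_add,
    map_sub, ContinuousLinearMap.comp_apply, hG.fderiv_apply hy]
  ring

theorem hasFDerivAt_scalarCurvature (hG : IsMetricOn G U) (hy : y ∈ U) {ι : Type*} [Fintype ι]
    (b : Module.Basis ι ℝ E) :
    HasFDerivAt (scalarCurvature G)
      (∑ i, coordCLM b i ∘L fderiv ℝ (fun z => ricciOperator G z (b i)) y) y := by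
  have : scalarCurvature G = fun z => ∑ i, b.repr (ricciOperator G z (b i)) i := by
    funext z; exact scalarCurvature_eq_sum G b z
  rw [this]
  exact HasFDerivAt.fun_sum fun i _ =>
    (coordCLM b i).hasFDerivAt.comp y (hG.differentiableAt_ricciOperator hy (b i)).hasFDerivAt

theorem sum_repr_covDerivRicciOperator (hG : IsMetricOn G U) (hy : y ∈ U) {ι : Type*} [Fintype ι]
    (b : Module.Basis ι ℝ E) (V : E) :
    ∑ i, b.repr (covDerivRicciOperator G y V (b i)) i = fderiv ℝ (scalarCurvature G) y V := by
  have hc := sum_repr_comp_comm b (christoffel G y V : E →ₗ[ℝ] E) (ricciOperator G y)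
  simp only [ContinuousLinearMap.coe_coe] at hc
  simp only [(hG.hasFDerivAt_scalarCurvature hy b).fderiv, covDerivRicciOperator, map_add,
    map_sub, Finsupp.add_apply, Finsupp.sub_apply, Finset.sum_add_distrib,
    Finset.sum_sub_distrib, hc]
  simp

/-- The twice contracted second Bianchi identity: `2 div Ric = dτ`. -/
theorem two_mul_div_ricciOperator (hG : IsMetricOn G U) (hy : y ∈ U) {ι : Type*} [Fintype ι]
    (b : Module.Basis ι ℝ E) (Y : E) :
    2 * ∑ i, b.repr (covDerivRicciOperator G y (b i) Y) i
      = fderiv ℝ (scalarCurvature G) y Y := by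
  -- The metrically dual basis: pairing with `d i` reads off the `i`-th coordinate, so metric traces
  -- need no orthonormal frame.
  set d : ι → E := fun i => sharp G y (coordCLM b i)
  have hd : ∀ i v, b.repr v i = G y v (d i) := fun i v => by
    rw [hG.symm y hy, hG.apply_sharp hy]; rfl
  -- Both sides are double traces of ∇R. After exchanging the sums they agree term by term, by
  -- skew-symmetry in the first two arguments and skew-adjointness; the result reads dτ - div Ric =
  -- div Ric.
  have h1 : ∑ i, (covDerivRicci G y Y (b i) (d i) - covDerivRicci G y (b i) Y (d i))
      = ∑ i, covDerivRicci G y (b i) Y (d i) := by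
    simp_rw [← hG.div_riemann hy b, ← hG.sum_repr_covDerivRiemann hy b]
    rw [Finset.sum_comm]
    refine Finset.sum_congr rfl fun j _ => Finset.sum_congr rfl fun i _ => ?_
    have hs : covDerivRiemann G y (b j) Y (b i) (d j)
        = - covDerivRiemann G y (b j) (b i) Y (d j) := by
      have e : (fun z => riemann G z Y (b i) (d j)) = fun z => - riemann G z (b i) Y (d j) := by
        funext z; exact riemann_swap G z _ _ _
      simp only [covDerivRiemann, e, fderiv_fun_neg, riemann_swap G y (christoffel G y (b j) Y),
        riemann_swap G y Y]
      simp
      abel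
    have := hG.covDerivRiemann_skew hy (b j) (b i) Y (d i) (d j)
    rw [hs, map_neg, Finsupp.neg_apply, hd, hd,
      hG.symm y hy (covDerivRiemann G y (b j) (b i) Y (d j))]
    linarith
  rw [Finset.sum_sub_distrib] at h1
  simp only [← hG.apply_covDerivRicciOperator hy, ← hd,
    hG.sum_repr_covDerivRicciOperator hy b] at h1
  linarith

/-- The metric is parallel, so in the correction term of the concircular tensor only τ gets
differentiated. -/
theorem covDerivConcircular_eq (hG : IsMetricOn G U) (hy : y ∈ U) (V X Y Z : E) :
    covDerivConcircular G y X Y Z V = covDerivRiemann G y V X Y Z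
      - (fderiv ℝ (scalarCurvature G) y V
          / ((Module.finrank ℝ E : ℝ) * ((Module.finrank ℝ E : ℝ) - 1))) •
        (G y X Z • Y - G y Y Z • X) := by
  set k : ℝ := ((Module.finrank ℝ E : ℝ) * ((Module.finrank ℝ E : ℝ) - 1))⁻¹ with hk
  have hg := (hG.differentiableAt hy).hasFDerivAt
  have hτ := (hG.hasFDerivAt_scalarCurvature hy (Module.finBasis ℝ E)).differentiableAt.hasFDerivAt
  have h1 := (hG.differentiableAt_riemann hy X Y Z).hasFDerivAt.sub ((hτ.mul_const k).smul
    (((hasFDerivAt_apply (hasFDerivAt_apply hg X) Z).smul_const Y).sub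
      ((hasFDerivAt_apply (hasFDerivAt_apply hg Y) Z).smul_const X)))
  have he : (fun z => concircular G z X Y Z) = fun z => riemann G z X Y Z
      - (scalarCurvature G z * k) • (G z X Z • Y - G z Y Z • X) := by
    funext z; rw [concircular_apply, div_eq_mul_inv]
  have h2 := h1.congr_of_eventuallyEq (Filter.Eventually.of_forall (congrFun he))
  change fderiv ℝ (fun z => concircular G z X Y Z) y V
    + christoffel G y V (concircular G y X Y Z)
    - concircular G y (christoffel G y V X) Y Z
    - concircular G y X (christoffel G y V Y) Z
    - concircular G y X Y (christoffel G y V Z) = _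
  rw [h2.fderiv]
  simp only [concircular_apply, covDerivRiemann, div_eq_mul_inv, ← hk, add_apply, sub_apply,
    ContinuousLinearMap.flip_apply, smul_apply, Pi.sub_apply, map_sub, map_smul,
    ContinuousLinearMap.smulRight_apply, hG.fderiv_apply hy, smul_eq_mul]
  module

theorem divConcircular_eq (hG : IsMetricOn G U) (hy : y ∈ U) (X Y Z : E) :
    divConcircular G y X Y Z = covDerivRicci G y Y X Z - covDerivRicci G y X Y Z
      - (G y X Z * fderiv ℝ (scalarCurvature G) y Y - G y Y Z * fderiv ℝ (scalarCurvature G) y X)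
        / ((Module.finrank ℝ E : ℝ) * ((Module.finrank ℝ E : ℝ) - 1)) := by
  set b := Module.finBasis ℝ E
  have hs := sum_apply_mul_repr b (fderiv ℝ (scalarCurvature G) y : E →ₗ[ℝ] ℝ)
  simp only [ContinuousLinearMap.coe_coe] at hs
  rw [divConcircular, trace_eq_sum_repr b, ← hG.div_riemann hy b, ← hs X, ← hs Y, Finset.mul_sum,
    Finset.mul_sum, ← Finset.sum_sub_distrib, Finset.sum_div, ← Finset.sum_sub_distrib]
  refine Finset.sum_congr rfl fun i _ => ?_
  rw [hG.covDerivConcircular_eq hy]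
  simp
  ring

/-- Outside dimension two, a divergence free concircular tensor forces `dτ = 0`. -/
theorem fderiv_scalarCurvature_eq_zero (hG : IsMetricOn G U) (hy : y ∈ U)
    (hdim : Module.finrank ℝ E ≠ 2) (h : ∀ X Y Z, divConcircular G y X Y Z = 0) :
    fderiv ℝ (scalarCurvature G) y = 0 := by
  set b := Module.finBasis ℝ E
  set n : ℝ := (Module.finrank ℝ E : ℝ) with hn
  set k : ℝ := (n * (n - 1))⁻¹ with hk
  -- The argument `Z` is removed by nondegeneracy, leaving an identity of vectors that can be traced
  -- over `X`.
  have hop : ∀ X Y, covDerivRicciOperator G y Y X - covDerivRicciOperator G y X Y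
      = (k * fderiv ℝ (scalarCurvature G) y Y) • X
        - (k * fderiv ℝ (scalarCurvature G) y X) • Y := fun X Y => hG.ext hy fun Z => by
    have := h X Y Z
    rw [hG.divConcircular_eq hy, div_eq_mul_inv, ← hn, ← hk] at this
    simp only [map_sub, map_smul, sub_apply, smul_apply,
      hG.apply_covDerivRicciOperator hy, smul_eq_mul]
    linarith
  ext Y
  set t := fderiv ℝ (scalarCurvature G) y Y with ht
  -- The trace of `hop` over `X`: the left side gives dτ(Y) - div Ric(Y), with div Ric = dτ / 2.
  have h1 : t - 2⁻¹ * t = k * t * n - k * t := by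
    have e : ∑ i, b.repr (covDerivRicciOperator G y Y (b i) - covDerivRicciOperator G y (b i) Y) i
        = ∑ i, b.repr ((k * fderiv ℝ (scalarCurvature G) y Y) • b i
          - (k * fderiv ℝ (scalarCurvature G) y (b i)) • Y) i :=
      Finset.sum_congr rfl fun i _ => by rw [hop]
    have hs := sum_apply_mul_repr b (fderiv ℝ (scalarCurvature G) y : E →ₗ[ℝ] ℝ) Y
    simp only [ContinuousLinearMap.coe_coe] at hs
    have h2 := hG.two_mul_div_ricciOperator hy b Y
    simp only [map_sub, map_smul, Finsupp.sub_apply, Finsupp.smul_apply, smul_eq_mul,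
      Finset.sum_sub_distrib, hG.sum_repr_covDerivRicciOperator hy b, mul_assoc,
      ← Finset.mul_sum, hs, Module.Basis.repr_self, Finsupp.single_eq_same, Finset.sum_const,
      Finset.card_univ, Fintype.card_fin, nsmul_eq_mul, mul_one] at e
    rw [← hn] at e
    linarith
  have h3 : (2⁻¹ - k * (n - 1)) * t = 0 := by linarith
  rcases mul_eq_zero.mp h3 with h4 | h4
  · exfalso
    -- In dimension one the coefficient is simply 1/2. Otherwise it is 1/2 - 1/n, where `0⁻¹ = 0`
    -- makes the computation valid for n = 0 too.
    by_cases h0 : n - 1 = 0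
    · rw [h0] at h4; norm_num at h4
    · have hk' : k * (n - 1) = n⁻¹ := by
        rw [hk, mul_inv, mul_assoc, inv_mul_cancel₀ h0, mul_one]
      rw [hk', sub_eq_zero, inv_inj] at h4
      have h5 : (Module.finrank ℝ E : ℝ) = 2 := h4.symm
      exact hdim (by exact_mod_cast h5)
  · simpa using h4

theorem covDerivRicci_comm_of_divConcircular (hG : IsMetricOn G U) (hy : y ∈ U)
    (hdim : Module.finrank ℝ E ≠ 2) (h : ∀ X Y Z, divConcircular G y X Y Z = 0) (X Y Z : E) :
    covDerivRicci G y Y X Z = covDerivRicci G y X Y Z := by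
  have := h X Y Z
  rw [hG.divConcircular_eq hy, hG.fderiv_scalarCurvature_eq_zero hy hdim h] at this
  simpa [sub_eq_zero] using this

end IsMetricOn

end LocalMetric

/-! ### Connection and curvature of a warped product with parallel gradient. -/

namespace LocalMetric

variable {E₁ E₂ : Type*} [NormedAddCommGroup E₁] [NormedSpace ℝ E₁]
  [NormedAddCommGroup E₂] [NormedSpace ℝ E₂]

/-- The warped product `G₁ + F² G₂` of two metrics. -/
noncomputable def warped (G₁ : E₁ → E₁ →L[ℝ] E₁ →L[ℝ] ℝ) (G₂ : E₂ → E₂ →L[ℝ] E₂ →L[ℝ] ℝ) (F : E₁ → ℝ)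
    (z : E₁ × E₂) : (E₁ × E₂) →L[ℝ] (E₁ × E₂) →L[ℝ] ℝ :=
  (G₁ z.1).bilinearComp (ContinuousLinearMap.fst ℝ E₁ E₂) (ContinuousLinearMap.fst ℝ E₁ E₂)
    + (F z.1) ^ 2 • (G₂ z.2).bilinearComp
      (ContinuousLinearMap.snd ℝ E₁ E₂) (ContinuousLinearMap.snd ℝ E₁ E₂)

@[simp] theorem warped_apply (G₁ : E₁ → E₁ →L[ℝ] E₁ →L[ℝ] ℝ) (G₂ : E₂ → E₂ →L[ℝ] E₂ →L[ℝ] ℝ)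
    (F : E₁ → ℝ) (z X Y : E₁ × E₂) :
    warped G₁ G₂ F z X Y = G₁ z.1 X.1 Y.1 + (F z.1) ^ 2 * G₂ z.2 X.2 Y.2 := rfl

/-- Data of a warped product over a base on which the gradient `N` of the warping function `F`
is parallel. -/
structure IsWarpingOn (G₁ : E₁ → E₁ →L[ℝ] E₁ →L[ℝ] ℝ) (U₁ : Set E₁)
    (G₂ : E₂ → E₂ →L[ℝ] E₂ →L[ℝ] ℝ) (U₂ : Set E₂) (F : E₁ → ℝ) (N : E₁ → E₁) : Prop where
  base : IsMetricOn G₁ U₁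
  fiber : IsMetricOn G₂ U₂
  contDiffOn : ContDiffOn ℝ ∞ F U₁
  pos : ∀ y ∈ U₁, 0 < F y
  hasFDerivAt : ∀ y ∈ U₁, HasFDerivAt F (G₁ y (N y)) y
  parallel : ∀ y ∈ U₁, HasFDerivAt N (-(christoffel G₁ y).flip (N y)) y

/-- The differential of `log F`. -/
noncomputable def dlog (G₁ : E₁ → E₁ →L[ℝ] E₁ →L[ℝ] ℝ) (F : E₁ → ℝ) (N : E₁ → E₁) (y : E₁) : E₁ →L[ℝ] ℝ :=
  (F y)⁻¹ • G₁ y (N y)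

namespace IsWarpingOn

variable {G₁ : E₁ → E₁ →L[ℝ] E₁ →L[ℝ] ℝ} {U₁ : Set E₁} {G₂ : E₂ → E₂ →L[ℝ] E₂ →L[ℝ] ℝ}
  {U₂ : Set E₂} {F : E₁ → ℝ} {N : E₁ → E₁} {y : E₁ × E₂}

theorem mul_dlog (h : IsWarpingOn G₁ U₁ G₂ U₂ F N) {y : E₁} (hy : y ∈ U₁) (X : E₁) :
    F y * dlog G₁ F N y X = G₁ y (N y) X := by
  have := (h.pos y hy).ne'
  simp [dlog]
  field_simp

theorem isMetricOn (h : IsWarpingOn G₁ U₁ G₂ U₂ F N) :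
    IsMetricOn (warped G₁ G₂ F) (U₁ ×ˢ U₂) where
  isOpen := h.base.isOpen.prod h.fiber.isOpen
  contDiffOn := by
    have hF := h.contDiffOn.comp (contDiff_fst (𝕜 := ℝ) (E := E₁) (F := E₂) (n := ∞)).contDiffOn
      (s := U₁ ×ˢ U₂) (fun z hz => hz.1)
    have h₁ := h.base.contDiffOn.comp (contDiff_fst (𝕜 := ℝ) (E := E₁) (F := E₂)).contDiffOn
      (s := U₁ ×ˢ U₂) (fun z hz => hz.1)
    have h₂ := h.fiber.contDiffOn.comp (contDiff_snd (𝕜 := ℝ) (E := E₁) (F := E₂)).contDiffOn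
      (s := U₁ ×ˢ U₂) (fun z hz => hz.2)
    exact (contDiffOn_bilinearComp h₁ _).add ((hF.pow 2).smul (contDiffOn_bilinearComp h₂ _))
  symm y hy v w := by
    simp [h.base.symm y.1 hy.1 v.1, h.fiber.symm y.2 hy.2 v.2]
  nondegenerate y hy v hv := by
    refine Prod.ext (h.base.nondegenerate y.1 hy.1 _ fun w => ?_)
      (h.fiber.nondegenerate y.2 hy.2 _ fun w => ?_)
    · simpa using hv (w, 0)
    · simpa [(h.pos y.1 hy.1).ne'] using hv (0, w)

variable [FiniteDimensional ℝ E₁] [FiniteDimensional ℝ E₂]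

/-- By uniqueness it suffices that the proposed connection is symmetric and metric; the warped
metric need not be inverted. -/
theorem christoffel_eq (h : IsWarpingOn G₁ U₁ G₂ U₂ F N) (hy : y ∈ U₁ ×ˢ U₂) (X Y : E₁ × E₂) :
    christoffel (warped G₁ G₂ F) y X Y =
      (christoffel G₁ y.1 X.1 Y.1 - (F y.1 * G₂ y.2 X.2 Y.2) • N y.1,
        christoffel G₂ y.2 X.2 Y.2 + dlog G₁ F N y.1 X.1 • Y.2 + dlog G₁ F N y.1 Y.1 • X.2) := by
  refine h.isMetricOn.christoffel_unique hy (Γ := fun X Y =>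
      (christoffel G₁ y.1 X.1 Y.1 - (F y.1 * G₂ y.2 X.2 Y.2) • N y.1,
        christoffel G₂ y.2 X.2 Y.2 + dlog G₁ F N y.1 X.1 • Y.2 + dlog G₁ F N y.1 Y.1 • X.2))
      (fun X Y => ?_) (fun V X Y => ?_) X Y
  · simp only [h.base.christoffel_symm hy.1 X.1, h.fiber.christoffel_symm hy.2 X.2,
      h.fiber.symm _ hy.2 X.2, add_right_comm]
  · have hg := hasFDerivAt_apply (hasFDerivAt_apply
      (h.isMetricOn.differentiableAt hy).hasFDerivAt X) Y
    have h1 := (hasFDerivAt_apply (hasFDerivAt_apply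
      (h.base.differentiableAt hy.1).hasFDerivAt X.1) Y.1).comp y hasFDerivAt_fst
    have h2 := (hasFDerivAt_apply (hasFDerivAt_apply
      (h.fiber.differentiableAt hy.2).hasFDerivAt X.2) Y.2).comp y hasFDerivAt_snd
    have hF := ((h.hasFDerivAt y.1 hy.1).pow 2).comp y hasFDerivAt_fst
    have := congrArg (fun φ : (E₁ × E₂) →L[ℝ] ℝ => φ V) (hg.unique (h1.add (hF.mul h2)))
    simp only [ContinuousLinearMap.flip_apply, add_apply, smul_apply, smul_eq_mul,
      ContinuousLinearMap.comp_apply, ContinuousLinearMap.coe_fst', ContinuousLinearMap.coe_snd',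
      h.base.fderiv_apply hy.1, h.fiber.fderiv_apply hy.2, Function.comp_apply] at this
    rw [this]
    simp only [warped_apply, map_add, map_sub, map_smul, add_apply, sub_apply, smul_apply,
      smul_eq_mul, ← h.mul_dlog hy.1, h.base.symm _ hy.1 _ (N y.1), h.fiber.symm _ hy.2 X.2 V.2]
    simp
    ring

/-- Since N is parallel, its derivative is -Γ(·, N), so no second derivatives of `F` survive. -/
theorem fderiv_christoffel_eq (h : IsWarpingOn G₁ U₁ G₂ U₂ F N) (hy : y ∈ U₁ ×ˢ U₂)
    (V X Y : E₁ × E₂) :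
    fderiv ℝ (christoffel (warped G₁ G₂ F)) y V X Y =
      (fderiv ℝ (christoffel G₁) y.1 V.1 X.1 Y.1
        - (F y.1 * dlog G₁ F N y.1 V.1 * G₂ y.2 X.2 Y.2
          + F y.1 * (G₂ y.2 (christoffel G₂ y.2 V.2 X.2) Y.2
            + G₂ y.2 X.2 (christoffel G₂ y.2 V.2 Y.2))) • N y.1
        + (F y.1 * G₂ y.2 X.2 Y.2) • christoffel G₁ y.1 V.1 (N y.1),
      fderiv ℝ (christoffel G₂) y.2 V.2 X.2 Y.2
        + (dlog G₁ F N y.1 (christoffel G₁ y.1 V.1 X.1)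
          - dlog G₁ F N y.1 V.1 * dlog G₁ F N y.1 X.1) • Y.2
        + (dlog G₁ F N y.1 (christoffel G₁ y.1 V.1 Y.1)
          - dlog G₁ F N y.1 V.1 * dlog G₁ F N y.1 Y.1) • X.2) := by
  have hg := hasFDerivAt_apply (hasFDerivAt_apply
    (h.isMetricOn.differentiableAt_christoffel hy).hasFDerivAt X) Y
  have h1 := (hasFDerivAt_apply (hasFDerivAt_apply
    (h.base.differentiableAt_christoffel hy.1).hasFDerivAt X.1) Y.1).comp y hasFDerivAt_fst
  have h2 := (hasFDerivAt_apply (hasFDerivAt_apply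
    (h.fiber.differentiableAt_christoffel hy.2).hasFDerivAt X.2) Y.2).comp y hasFDerivAt_snd
  have hG₂ := (hasFDerivAt_apply (hasFDerivAt_apply
    (h.fiber.differentiableAt hy.2).hasFDerivAt X.2) Y.2).comp y hasFDerivAt_snd
  have hF := (h.hasFDerivAt y.1 hy.1).comp y hasFDerivAt_fst
  have hN := (h.parallel y.1 hy.1).comp y hasFDerivAt_fst
  -- This is ∇(d log F) = -(d log F) ⊗ (d log F), which holds because N = grad F is parallel.
  have hp : ∀ A : E₁, ∃ L : (E₁ × E₂) →L[ℝ] ℝ,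
      HasFDerivAt (fun z : E₁ × E₂ => dlog G₁ F N z.1 A) L y ∧ ∀ V, L V =
        dlog G₁ F N y.1 (christoffel G₁ y.1 V.1 A)
          - dlog G₁ F N y.1 V.1 * dlog G₁ F N y.1 A := by
    intro A
    have hF0 := (h.pos y.1 hy.1).ne'
    have hi := ((hasDerivAt_inv hF0).comp_hasFDerivAt y.1 (h.hasFDerivAt y.1 hy.1)).mul
      (hasFDerivAt_apply
        ((h.base.differentiableAt hy.1).hasFDerivAt.clm_apply (h.parallel y.1 hy.1)) A)
    refine ⟨_, hi.comp y hasFDerivAt_fst, fun V => ?_⟩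
    simp only [ContinuousLinearMap.flip_apply, add_apply, smul_apply, smul_eq_mul,
      ContinuousLinearMap.comp_apply, ContinuousLinearMap.coe_fst', Function.comp_apply,
      h.base.fderiv_apply hy.1, neg_apply, map_neg, dlog]
    field_simp
    ring
  obtain ⟨LX, hLX, eX⟩ := hp X.1
  obtain ⟨LY, hLY, eY⟩ := hp Y.1
  have hpair := (h1.sub ((hF.mul hG₂).smul hN)).prodMk
    ((h2.add (hLX.smul_const Y.2)).add (hLY.smul_const X.2))
  have he : (fun z => christoffel (warped G₁ G₂ F) z X Y) =ᶠ[nhds y] fun z =>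
      (christoffel G₁ z.1 X.1 Y.1 - (F z.1 * G₂ z.2 X.2 Y.2) • N z.1,
        christoffel G₂ z.2 X.2 Y.2 + dlog G₁ F N z.1 X.1 • Y.2
          + dlog G₁ F N z.1 Y.1 • X.2) := by
    filter_upwards [h.isMetricOn.isOpen.mem_nhds hy] with z hz using h.christoffel_eq hz X Y
  have := congrArg (fun φ : (E₁ × E₂) →L[ℝ] (E₁ × E₂) => φ V)
    (hg.unique (hpair.congr_of_eventuallyEq he))
  simp only [ContinuousLinearMap.flip_apply] at this
  rw [this]
  simp only [ContinuousLinearMap.prod_apply, add_apply, sub_apply, smul_apply, neg_apply,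
    ContinuousLinearMap.smulRight_apply, ContinuousLinearMap.comp_apply, eX, eY,
    ContinuousLinearMap.coe_fst', ContinuousLinearMap.coe_snd', ContinuousLinearMap.flip_apply,
    h.fiber.fderiv_apply hy.2, ← h.mul_dlog hy.1, Function.comp_apply, smul_eq_mul,
    Pi.mul_apply]
  refine Prod.ext ?_ rfl
  simp only
  module

/-- The curvature of the warped product is block diagonal. -/
theorem riemann_eq (h : IsWarpingOn G₁ U₁ G₂ U₂ F N) (hy : y ∈ U₁ ×ˢ U₂) (X Y Z : E₁ × E₂) :
    riemann (warped G₁ G₂ F) y X Y Z =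
      (riemann G₁ y.1 X.1 Y.1 Z.1, riemann G₂ y.2 X.2 Y.2 Z.2
        - G₁ y.1 (N y.1) (N y.1) • (G₂ y.2 X.2 Z.2 • Y.2 - G₂ y.2 Y.2 Z.2 • X.2)) := by
  simp only [riemann_apply, h.christoffel_eq hy, h.fderiv_christoffel_eq hy,
    ← h.mul_dlog hy.1 (N y.1)]
  refine Prod.ext ?_ ?_
  · simp only [Prod.fst_add, Prod.fst_sub, map_add, map_sub, map_smul, smul_eq_mul,
      h.base.christoffel_symm hy.1 X.1 Y.1, h.fiber.christoffel_symm hy.2 X.2 Y.2, h.fiber.symm _ hy.2 X.2 Y.2,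
      h.fiber.symm _ hy.2 X.2 (christoffel G₂ y.2 Y.2 Z.2)]
    rw [h.fiber.symm _ hy.2 (christoffel G₂ y.2 Y.2 Z.2)]
    module
  · simp only [Prod.snd_add, Prod.snd_sub, map_add, map_sub, map_smul, smul_eq_mul,
      h.base.christoffel_symm hy.1 X.1 Y.1, h.fiber.christoffel_symm hy.2 X.2 Y.2]
    module

/-- The trace splits over the blocks. In the fibre, the identity contributes n₂ and the rank-one
term -1, whence the factor n₂ - 1. -/
theorem ricci_eq (h : IsWarpingOn G₁ U₁ G₂ U₂ F N) (hy : y ∈ U₁ ×ˢ U₂) (Y Z : E₁ × E₂) :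
    ricci (warped G₁ G₂ F) y Y Z = ricci G₁ y.1 Y.1 Z.1 + (ricci G₂ y.2 Y.2 Z.2
      - ((Module.finrank ℝ E₂ : ℝ) - 1) * G₁ y.1 (N y.1) (N y.1) * G₂ y.2 Y.2 Z.2) := by
  set s := G₁ y.1 (N y.1) (N y.1) with hs
  have hmap : (riemann (warped G₁ G₂ F) y Y).flip Z
      = LinearMap.prodMap ((riemann G₁ y.1 Y.1).flip Z.1) ((riemann G₂ y.2 Y.2).flip Z.2
        - s • (G₂ y.2 Y.2 Z.2 • LinearMap.id
          - (((G₂ y.2).flip Z.2 : E₂ →L[ℝ] ℝ) : E₂ →ₗ[ℝ] ℝ).smulRight Y.2)) := by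
    refine LinearMap.ext fun V => ?_
    rw [LinearMap.flip_apply, h.riemann_eq hy]
    rfl
  have ht : LinearMap.trace ℝ E₂
      ((((G₂ y.2).flip Z.2 : E₂ →L[ℝ] ℝ) : E₂ →ₗ[ℝ] ℝ).smulRight Y.2) = G₂ y.2 Y.2 Z.2 := by
    have := sum_apply_mul_repr (Module.finBasis ℝ E₂)
      (((G₂ y.2).flip Z.2 : E₂ →L[ℝ] ℝ) : E₂ →ₗ[ℝ] ℝ) Y.2
    rw [trace_eq_sum_repr (Module.finBasis ℝ E₂)]
    simpa using this
  rw [ricci_apply, hmap, LinearMap.trace_prodMap', map_sub, map_smul, map_sub, map_smul, ht,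
    LinearMap.trace_id, ricci_apply, ricci_apply, smul_eq_mul, smul_eq_mul]
  ring

end IsWarpingOn

end LocalMetric

/-! ### The divergence criterion on warped products. -/

namespace LocalMetric

namespace IsMetricOn

variable {E : Type*} [NormedAddCommGroup E] [NormedSpace ℝ E] [FiniteDimensional ℝ E]
  {G : E → E →L[ℝ] E →L[ℝ] ℝ} {U : Set E} {N : E → E} {y : E}

/-- A parallel field is annihilated by the curvature. -/
theorem riemann_parallel (hG : IsMetricOn G U)
    (hN : ∀ y ∈ U, HasFDerivAt N (-(christoffel G y).flip (N y)) y) (hy : y ∈ U) (X Y : E) :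
    riemann G y X Y (N y) = 0 := by
  have hΓ := (hG.differentiableAt_christoffel hy).hasFDerivAt
  have hflip : HasFDerivAt (fun z => (christoffel G z).flip)
      ((ContinuousLinearMap.flipₗᵢ ℝ E E E).toContinuousLinearEquiv.toContinuousLinearMap
        ∘L fderiv ℝ (christoffel G) y) y :=
    (ContinuousLinearMap.flipₗᵢ ℝ E E E).toContinuousLinearEquiv.hasFDerivAt.comp y hΓ
  have h2 := (hflip.clm_apply (hN y hy)).neg
  -- The integrability condition of DN = -Γ(·, N), that is, the symmetry of the second derivative of
  -- `N`, says R(X, Y) N = 0.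
  have hs := second_derivative_symmetric_of_eventually_of_real (f := N)
    (by filter_upwards [hG.isOpen.mem_nhds hy] with z hz using hN z hz) h2 X Y
  simp only [neg_apply, add_apply, ContinuousLinearMap.comp_apply, ContinuousLinearMap.flip_apply,
    map_neg, neg_neg, neg_add_rev] at hs
  have hs' : -(fderiv ℝ (christoffel G) y X Y (N y))
        + christoffel G y Y (christoffel G y X (N y))
      = -(fderiv ℝ (christoffel G) y Y X (N y))
        + christoffel G y X (christoffel G y Y (N y)) := hs
  rw [riemann_apply, ← sub_eq_zero.mpr hs']
  abel

theorem ricci_parallel (hG : IsMetricOn G U)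
    (hN : ∀ y ∈ U, HasFDerivAt N (-(christoffel G y).flip (N y)) y) (hy : y ∈ U) (X : E) :
    ricci G y X (N y) = 0 := by
  simp [ricci_eq_sum G (Module.finBasis ℝ E), hG.riemann_parallel hN hy]

theorem divConcircular_eq_zero (hG : IsMetricOn G U) (hy : y ∈ U)
    (hτ : fderiv ℝ (scalarCurvature G) y = 0)
    (hR : ∀ X Y Z, covDerivRicci G y Y X Z = covDerivRicci G y X Y Z) (X Y Z : E) :
    divConcircular G y X Y Z = 0 := by
  rw [hG.divConcircular_eq hy, hτ, hR]
  simp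

end IsMetricOn

variable {E₁ E₂ : Type*} [NormedAddCommGroup E₁] [NormedSpace ℝ E₁]
  [NormedAddCommGroup E₂] [NormedSpace ℝ E₂] [FiniteDimensional ℝ E₁] [FiniteDimensional ℝ E₂]

namespace IsWarpingOn

variable {G₁ : E₁ → E₁ →L[ℝ] E₁ →L[ℝ] ℝ} {U₁ : Set E₁} {G₂ : E₂ → E₂ →L[ℝ] E₂ →L[ℝ] ℝ}
  {U₂ : Set E₂} {F : E₁ → ℝ} {N : E₁ → E₁} {y : E₁ × E₂} {ε : ℝ}

/-- The factor F⁻² arises from raising a fibre index with the metric F² g₂. -/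
theorem scalarCurvature_eq (h : IsWarpingOn G₁ U₁ G₂ U₂ F N) (hy : y ∈ U₁ ×ˢ U₂)
    (hRic : ∀ X Y : E₁ × E₂, ricci (warped G₁ G₂ F) y X Y
      = ricci G₁ y.1 X.1 Y.1 + ε * ricci G₂ y.2 X.2 Y.2) :
    scalarCurvature (warped G₁ G₂ F) y
      = scalarCurvature G₁ y.1 + ε * ((F y.1 ^ 2)⁻¹ * scalarCurvature G₂ y.2) := by
  have hF := (h.pos y.1 hy.1).ne'
  have hQ : ricciOperator (warped G₁ G₂ F) y = LinearMap.prodMap (ricciOperator G₁ y.1)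
      ((ε * (F y.1 ^ 2)⁻¹) • ricciOperator G₂ y.2) := by
    refine LinearMap.ext fun X => h.isMetricOn.ext hy fun Y => ?_
    rw [h.isMetricOn.apply_ricciOperator hy, hRic]
    simp only [warped_apply, LinearMap.prodMap_apply, LinearMap.smul_apply, map_smul, smul_apply,
      smul_eq_mul, h.base.apply_ricciOperator hy.1, h.fiber.apply_ricciOperator hy.2]
    field_simp
  change LinearMap.trace ℝ (E₁ × E₂) (ricciOperator (warped G₁ G₂ F) y) = _
  rw [hQ, LinearMap.trace_prodMap', map_smul, smul_eq_mul, mul_assoc]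
  rfl

/-- Common core of the two cases: either the fibre has dropped out of Ric, or the gradient vanishes
at the point and the fibre enters on the same footing as the base. -/
theorem divConcircular_eq_zero (h : IsWarpingOn G₁ U₁ G₂ U₂ F N)
    (hRic : ∀ y ∈ U₁ ×ˢ U₂, ∀ X Y : E₁ × E₂, ricci (warped G₁ G₂ F) y X Y
      = ricci G₁ y.1 X.1 Y.1 + ε * ricci G₂ y.2 X.2 Y.2)
    (hy : y ∈ U₁ ×ˢ U₂) (hdim₁ : Module.finrank ℝ E₁ ≠ 2)
    (h₁ : ∀ X Y Z, divConcircular G₁ y.1 X Y Z = 0)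
    (hε : ε = 0 ∨ N y.1 = 0 ∧ Module.finrank ℝ E₂ ≠ 2 ∧
      ∀ X Y Z, divConcircular G₂ y.2 X Y Z = 0) (X Y Z : E₁ × E₂) :
    divConcircular (warped G₁ G₂ F) y X Y Z = 0 := by
  have hU := h.isMetricOn.isOpen.mem_nhds hy
  refine h.isMetricOn.divConcircular_eq_zero hy ?_ (fun X Y Z => ?_) X Y Z
  · have hF0 : F y.1 ^ 2 ≠ 0 := pow_ne_zero 2 (h.pos y.1 hy.1).ne'
    have hF := (hasDerivAt_inv hF0).comp_hasFDerivAt y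
      (((h.hasFDerivAt y.1 hy.1).pow 2).comp y hasFDerivAt_fst)
    have hτ₁ := (h.base.hasFDerivAt_scalarCurvature hy.1
      (Module.finBasis ℝ E₁)).differentiableAt.hasFDerivAt
    rw [h.base.fderiv_scalarCurvature_eq_zero hy.1 hdim₁ h₁] at hτ₁
    have hτ₂ := (h.fiber.hasFDerivAt_scalarCurvature hy.2
      (Module.finBasis ℝ E₂)).differentiableAt.hasFDerivAt
    have hd := (hτ₁.comp y hasFDerivAt_fst).add
      ((hF.mul (hτ₂.comp y hasFDerivAt_snd)).const_mul ε)
    have he : scalarCurvature (warped G₁ G₂ F) =ᶠ[nhds y] fun z =>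
        scalarCurvature G₁ z.1 + ε * ((F z.1 ^ 2)⁻¹ * scalarCurvature G₂ z.2) := by
      filter_upwards [hU] with z hz using h.scalarCurvature_eq hz (hRic z hz)
    rw [(hd.congr_of_eventuallyEq he).fderiv]
    rcases hε with rfl | ⟨hN, hdim₂, h₂⟩
    · simp
    · simp [hN, h.fiber.fderiv_scalarCurvature_eq_zero hy.2 hdim₂ h₂]
  · have hD : ∀ V A B : E₁ × E₂, fderiv ℝ (fun z => ricci (warped G₁ G₂ F) z A B) y V
        = fderiv ℝ (fun z => ricci G₁ z A.1 B.1) y.1 V.1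
          + ε * fderiv ℝ (fun z => ricci G₂ z A.2 B.2) y.2 V.2 := by
      intro V A B
      have hd := ((h.base.differentiableAt_ricci hy.1 A.1 B.1).hasFDerivAt.comp y
        hasFDerivAt_fst).add (((h.fiber.differentiableAt_ricci hy.2 A.2 B.2).hasFDerivAt.comp y
        hasFDerivAt_snd).const_mul ε)
      rw [(hd.congr_of_eventuallyEq (by
        filter_upwards [hU] with z hz using hRic z hz A B)).fderiv]
      rfl
    have hc₁ := h.base.covDerivRicci_comm_of_divConcircular hy.1 hdim₁ h₁ X.1 Y.1 Z.1
    simp only [covDerivRicci, h.base.christoffel_symm hy.1 X.1 Y.1] at hc₁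
    simp only [covDerivRicci, h.isMetricOn.christoffel_symm hy X Y, hD]
    rw [hRic y hy X, hRic y hy Y, h.christoffel_eq hy Y Z, h.christoffel_eq hy X Z]
    -- The horizontal part of Γ differs from that of the base by a multiple of N, which Ric¹
    -- annihilates. The mixed fibre terms remain; they disappear when ε = 0 or d log F = 0.
    simp only [map_sub, map_smul, h.base.ricci_parallel h.parallel hy.1, smul_zero, sub_zero]
    rcases hε with rfl | ⟨hN, hdim₂, h₂⟩
    · linarith
    · have hc₂ := h.fiber.covDerivRicci_comm_of_divConcircular hy.2 hdim₂ h₂ X.2 Y.2 Z.2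
      simp only [covDerivRicci, h.fiber.christoffel_symm hy.2 X.2 Y.2] at hc₂
      have hp : dlog G₁ F N y.1 = 0 := by simp [dlog, hN]
      simp only [hp, zero_apply, zero_smul, add_zero]
      linear_combination hc₁ + ε * hc₂

theorem divConcircular_of_gradient_eq_zero (h : IsWarpingOn G₁ U₁ G₂ U₂ F N)
    (hN : ∀ y ∈ U₁, N y = 0) (hdim₁ : Module.finrank ℝ E₁ ≠ 2) (hdim₂ : Module.finrank ℝ E₂ ≠ 2)
    (hy : y ∈ U₁ ×ˢ U₂) (h₁ : ∀ X Y Z, divConcircular G₁ y.1 X Y Z = 0)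
    (h₂ : ∀ X Y Z, divConcircular G₂ y.2 X Y Z = 0) (X Y Z : E₁ × E₂) :
    divConcircular (warped G₁ G₂ F) y X Y Z = 0 :=
  h.divConcircular_eq_zero (ε := 1)
    (fun z hz A B => by rw [h.ricci_eq hz, hN z.1 hz.1]; simp)
    hy hdim₁ h₁ (Or.inr ⟨hN y.1 hy.1, hdim₂, h₂⟩) X Y Z

theorem divConcircular_of_einstein (h : IsWarpingOn G₁ U₁ G₂ U₂ F N)
    (hE : ∀ y ∈ U₁ ×ˢ U₂, ∀ A B, ricci G₂ y.2 A B
      = ((Module.finrank ℝ E₂ : ℝ) - 1) * G₁ y.1 (N y.1) (N y.1) * G₂ y.2 A B)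
    (hdim₁ : Module.finrank ℝ E₁ ≠ 2) (hy : y ∈ U₁ ×ˢ U₂)
    (h₁ : ∀ X Y Z, divConcircular G₁ y.1 X Y Z = 0) (X Y Z : E₁ × E₂) :
    divConcircular (warped G₁ G₂ F) y X Y Z = 0 :=
  h.divConcircular_eq_zero (ε := 0)
    (fun z hz A B => by rw [h.ricci_eq hz, hE z hz]; ring)
    hy hdim₁ h₁ (Or.inl rfl) X Y Z

end IsWarpingOn

end LocalMetric

/-! ### Locality of the curvature quantities. -/

namespace LocalMetric

variable {E : Type*} [NormedAddCommGroup E] [NormedSpace ℝ E]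
  {G G' : E → E →L[ℝ] E →L[ℝ] ℝ} {y : E}

theorem christoffel_eventuallyEq (h : G =ᶠ[nhds y] G') :
    christoffel G =ᶠ[nhds y] christoffel G' := by
  filter_upwards [h, h.fderiv (𝕜 := ℝ)] with z h1 h2
  simp only [christoffel, christoffelLower, sharp, h1, h2]

theorem riemann_eventuallyEq (h : G =ᶠ[nhds y] G') : riemann G =ᶠ[nhds y] riemann G' := by
  have hΓ := christoffel_eventuallyEq h
  filter_upwards [hΓ, hΓ.fderiv (𝕜 := ℝ)] with z h1 h2
  ext X Y Z
  simp only [riemann_apply, h1, h2]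

variable [FiniteDimensional ℝ E]

theorem concircular_eventuallyEq (h : G =ᶠ[nhds y] G') :
    concircular G =ᶠ[nhds y] concircular G' := by
  filter_upwards [h, riemann_eventuallyEq h] with z h1 h2
  have h3 : ricci G z = ricci G' z := by
    ext X Y
    rw [ricci_apply, ricci_apply, h2]
  have h4 : scalarCurvature G z = scalarCurvature G' z := by
    rw [scalarCurvature, scalarCurvature, h3, sharp, sharp, h1]
  ext X Y Z
  rw [concircular_apply, concircular_apply, h1, h2, h4]

/-- The divergence of the concircular tensor depends only on the germ of the metric. -/
theorem divConcircular_congr (h : G =ᶠ[nhds y] G') (X Y Z : E) :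
    divConcircular G y X Y Z = divConcircular G' y X Y Z := by
  have hC := concircular_eventuallyEq h
  have hD : (fun z => concircular G z X Y Z) =ᶠ[nhds y] fun z => concircular G' z X Y Z := by
    filter_upwards [hC] with z hz
    rw [hz]
  have : covDerivConcircular G y X Y Z = covDerivConcircular G' y X Y Z := by
    ext V
    simp only [covDerivConcircular, LinearMap.coe_mk, AddHom.coe_mk, hD.fderiv_eq, hC.eq_of_nhds,
      (christoffel_eventuallyEq h).eq_of_nhds]
  rw [divConcircular, divConcircular, this]

end LocalMetric

/-! ### Passage from a manifold to its charts. -/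

section Charts

variable {E : Type*} [NormedAddCommGroup E] [NormedSpace ℝ E]
  {H : Type*} [TopologicalSpace H] {I : ModelWithCorners ℝ E H}
  {M : Type*} [TopologicalSpace M] [ChartedSpace H M]

namespace PseudoRiemannianMetric

variable (g : PseudoRiemannianMetric I M)

theorem inChart_apply (e : OpenPartialHomeomorph M H) (y v w : E) :
    g.inChart e y v w = g.val ((e.extend I).symm y) (chartInvDeriv I e y v)
      (chartInvDeriv I e y w) := rfl

theorem val_gradient [FiniteDimensional ℝ E] (f : M → ℝ) (x : M) (w : TangentSpace I x) :
    g.val x (g.gradient f x) w = mfderiv I 𝓘(ℝ, ℝ) f x w := by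
  -- The form on one tangent space is viewed as a constant metric field, so that `apply_sharp`
  -- applies to it.
  have hG : LocalMetric.IsMetricOn (fun _ : E => (g.val x : E →L[ℝ] E →L[ℝ] ℝ)) Set.univ :=
    ⟨isOpen_univ, contDiffOn_const, fun _ _ => g.symm x, fun _ _ => g.nondegenerate x⟩
  exact congrArg (fun φ : E →L[ℝ] ℝ => φ w)
    (hG.apply_sharp (Set.mem_univ (0 : E)) (mfderiv I 𝓘(ℝ, ℝ) f x))

theorem gradient_of_const {f : M → ℝ} {c : ℝ} (hc : ∀ p, f p = c) (x : M) :
    g.gradient f x = 0 := by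
  have : f = fun _ => c := funext hc
  rw [gradient, this, mfderiv_const]
  exact map_zero _

theorem vectorFieldInChart_gradient_of_const {f : M → ℝ} {c : ℝ} (hc : ∀ p, f p = c)
    (e : OpenPartialHomeomorph M H) (y : E) : vectorFieldInChart (g.gradient f) e y = 0 := by
  rw [vectorFieldInChart, g.gradient_of_const hc]
  exact map_zero _

theorem hessianEqZero_of_const {f : M → ℝ} {c : ℝ} (hc : ∀ p, f p = c) : g.HessianEqZero f := by
  intro e _ y _ Y Z
  have h0 : vectorFieldInChart (g.gradient f) e = fun _ => (0 : E) :=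
    funext (g.vectorFieldInChart_gradient_of_const hc e)
  simp [LocalMetric.covDeriv, h0]

end PseudoRiemannianMetric

variable [I.Boundaryless] [IsManifold I ∞ M] {e : OpenPartialHomeomorph M H} {y : E}

theorem hasMFDerivAt_extend_symm (he : e ∈ atlas H M) (hy : y ∈ (e.extend I).target) :
    HasMFDerivAt 𝓘(ℝ, E) I (e.extend I).symm y (chartInvDeriv I e y) :=
  ((contMDiffAt_extend_symm he hy).mdifferentiableAt (by simp)).hasMFDerivAt

/-- The chain rule for φ ∘ φ⁻¹, which is the identity near `y` because the target is open when there
is no boundary. -/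
theorem mfderiv_extend_chartInvDeriv (he : e ∈ atlas H M) (hy : y ∈ (e.extend I).target) (v : E) :
    (mfderiv I 𝓘(ℝ, E) (e.extend I) ((e.extend I).symm y) (chartInvDeriv I e y v) : E) = v := by
  have hx : (e.extend I).symm y ∈ e.source := by
    rw [← e.extend_source (I := I)]; exact (e.extend I).map_target hy
  have h1 := ((e.contMDiffAt_extend (IsManifold.subset_maximalAtlas (I := I) (n := ∞) he)
    hx).mdifferentiableAt (by simp)).hasMFDerivAt
  have h2 := HasMFDerivAt.comp y h1 (hasMFDerivAt_extend_symm he hy)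
  have h3 : HasMFDerivAt 𝓘(ℝ, E) 𝓘(ℝ, E) (id : E → E) y (ContinuousLinearMap.id ℝ E) :=
    hasMFDerivAt_id y
  have he' : (id : E → E) =ᶠ[nhds y] (e.extend I) ∘ (e.extend I).symm := by
    filter_upwards [e.isOpen_extend_target.mem_nhds hy] with z hz
      using ((e.extend I).right_inv hz).symm
  have h4 := hasMFDerivAt_unique (h2.congr_of_eventuallyEq he') h3
  exact congrArg (fun φ : E →L[ℝ] E => φ v) h4

theorem contDiffOn_comp_extend_symm {f : M → ℝ} (hf : ContMDiff I 𝓘(ℝ, ℝ) ∞ f)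
    (he : e ∈ atlas H M) : ContDiffOn ℝ ∞ (f ∘ (e.extend I).symm) (e.extend I).target :=
  fun _ hz => ((hf _).comp _ (contMDiffAt_extend_symm he hz)).contDiffAt.contDiffWithinAt

variable [FiniteDimensional ℝ E]

theorem chartInvDeriv_surjective (he : e ∈ atlas H M) (hy : y ∈ (e.extend I).target) :
    Function.Surjective (chartInvDeriv I e y) := by
  have key : ∀ A B : E →L[ℝ] E, (∀ v, B (A v) = v) → Function.Surjective A := fun A B hAB =>
    LinearMap.injective_iff_surjective.mp
      (Function.LeftInverse.injective hAB : Function.Injective (A : E →ₗ[ℝ] E))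
  exact key _ _ (mfderiv_extend_chartInvDeriv he hy)

theorem chartInvDeriv_mfderiv_extend (he : e ∈ atlas H M) (hy : y ∈ (e.extend I).target)
    (v : TangentSpace I ((e.extend I).symm y)) :
    chartInvDeriv I e y (mfderiv I 𝓘(ℝ, E) (e.extend I) ((e.extend I).symm y) v) = v := by
  obtain ⟨w, rfl⟩ := chartInvDeriv_surjective he hy v
  exact congrArg (chartInvDeriv I e y) (mfderiv_extend_chartInvDeriv he hy w)

namespace PseudoRiemannianMetric

variable (g : PseudoRiemannianMetric I M)

theorem isMetricOn_inChart (he : e ∈ atlas H M) :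
    LocalMetric.IsMetricOn (g.inChart e) (e.extend I).target where
  isOpen := e.isOpen_extend_target
  contDiffOn := g.smooth e he
  symm y _ v w := by rw [inChart_apply, inChart_apply, g.symm]
  nondegenerate y hy v hv := by
    have h0 : chartInvDeriv I e y v = 0 := g.nondegenerate _ _ fun w => by
      obtain ⟨w', hw'⟩ := chartInvDeriv_surjective he hy w
      rw [← hw', ← inChart_apply]
      exact hv w'
    rw [← mfderiv_extend_chartInvDeriv he hy v, h0]
    exact map_zero _

theorem hasFDerivAt_comp_extend_symm {f : M → ℝ} (hf : ContMDiff I 𝓘(ℝ, ℝ) ∞ f)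
    (he : e ∈ atlas H M) (hy : y ∈ (e.extend I).target) :
    HasFDerivAt (f ∘ (e.extend I).symm)
      (g.inChart e y (vectorFieldInChart (g.gradient f) e y)) y := by
  have h := HasMFDerivAt.comp y (((hf _).mdifferentiableAt (by simp)).hasMFDerivAt)
    (hasMFDerivAt_extend_symm he hy)
  refine (hasMFDerivAt_iff_hasFDerivAt.mp h).congr_fderiv ?_
  have hw (w : E) : g.inChart e y (vectorFieldInChart (g.gradient f) e y) w
      = mfderiv I 𝓘(ℝ, ℝ) f ((e.extend I).symm y) (chartInvDeriv I e y w) := by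
    rw [inChart_apply, vectorFieldInChart, chartInvDeriv_mfderiv_extend he hy, g.val_gradient]
  exact ContinuousLinearMap.ext fun w => (hw w).symm

theorem inChart_gradient_gradient (f : M → ℝ) (he : e ∈ atlas H M)
    (hy : y ∈ (e.extend I).target) :
    g.inChart e y (vectorFieldInChart (g.gradient f) e y) (vectorFieldInChart (g.gradient f) e y)
      = g.val ((e.extend I).symm y) (g.gradient f ((e.extend I).symm y))
        (g.gradient f ((e.extend I).symm y)) := by
  rw [inChart_apply, vectorFieldInChart, chartInvDeriv_mfderiv_extend he hy]

/-- The gradient is defined pointwise, so its regularity is not evident; in a chart it is the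
differential of f with its index raised by the smooth inverse metric. -/
theorem differentiableAt_gradientInChart {f : M → ℝ} (hf : ContMDiff I 𝓘(ℝ, ℝ) ∞ f)
    (he : e ∈ atlas H M) (hy : y ∈ (e.extend I).target) :
    DifferentiableAt ℝ (vectorFieldInChart (g.gradient f) e) y := by
  have hG := g.isMetricOn_inChart he
  have hU := hG.isOpen.mem_nhds hy
  have hF : DifferentiableAt ℝ (fderiv ℝ (f ∘ (e.extend I).symm)) y :=
    (((contDiffOn_comp_extend_symm hf he).contDiffAt hU).fderiv_right (m := ∞)
      (by simp)).differentiableAt (by simp)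
  have hS := (hG.contDiffAt_sharp hy).differentiableAt (by simp)
  refine (hS.clm_apply hF).congr_of_eventuallyEq ?_
  filter_upwards [hU] with z hz
  rw [(g.hasFDerivAt_comp_extend_symm hf he hz).fderiv, hG.sharp_apply hz]

/-- H^f = 0 gives ∇ grad f = 0 by nondegeneracy. Differentiability is needed separately, since
`fderiv` alone may be a default zero. -/
theorem hasFDerivAt_gradientInChart {f : M → ℝ} (hf : ContMDiff I 𝓘(ℝ, ℝ) ∞ f)
    (hH : g.HessianEqZero f) (he : e ∈ atlas H M) (hy : y ∈ (e.extend I).target) :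
    HasFDerivAt (vectorFieldInChart (g.gradient f) e)
      (-(LocalMetric.christoffel (g.inChart e) y).flip
        (vectorFieldInChart (g.gradient f) e y)) y := by
  refine (g.differentiableAt_gradientInChart hf he hy).hasFDerivAt.congr_fderiv ?_
  refine ContinuousLinearMap.ext fun V => eq_neg_of_add_eq_zero_left ?_
  exact (g.isMetricOn_inChart he).nondegenerate y hy _ fun Z => hH e he y hy V Z

end PseudoRiemannianMetric

end Charts

/-! ### Product charts and the theorem. -/

section WarpedProductCharts

variable {E₁ : Type*} [NormedAddCommGroup E₁] [NormedSpace ℝ E₁] [FiniteDimensional ℝ E₁]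
  {H₁ : Type*} [TopologicalSpace H₁] {I₁ : ModelWithCorners ℝ E₁ H₁} [I₁.Boundaryless]
  {M₁ : Type*} [TopologicalSpace M₁] [ChartedSpace H₁ M₁] [IsManifold I₁ ∞ M₁]
  {E₂ : Type*} [NormedAddCommGroup E₂] [NormedSpace ℝ E₂] [FiniteDimensional ℝ E₂]
  {H₂ : Type*} [TopologicalSpace H₂] {I₂ : ModelWithCorners ℝ E₂ H₂} [I₂.Boundaryless]
  {M₂ : Type*} [TopologicalSpace M₂] [ChartedSpace H₂ M₂] [IsManifold I₂ ∞ M₂]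

theorem isWarpingOn_inChart (g₁ : PseudoRiemannianMetric I₁ M₁)
    (g₂ : PseudoRiemannianMetric I₂ M₂) {f : M₁ → ℝ} (hf : ContMDiff I₁ 𝓘(ℝ, ℝ) ∞ f)
    (hpos : ∀ p, 0 < f p) (hH : g₁.HessianEqZero f)
    {e₁ : OpenPartialHomeomorph M₁ H₁} (he₁ : e₁ ∈ atlas H₁ M₁)
    {e₂ : OpenPartialHomeomorph M₂ H₂} (he₂ : e₂ ∈ atlas H₂ M₂) :
    LocalMetric.IsWarpingOn (g₁.inChart e₁) (e₁.extend I₁).target (g₂.inChart e₂)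
      (e₂.extend I₂).target (f ∘ (e₁.extend I₁).symm)
      (PseudoRiemannianMetric.vectorFieldInChart (g₁.gradient f) e₁) where
  base := g₁.isMetricOn_inChart he₁
  fiber := g₂.isMetricOn_inChart he₂
  contDiffOn := contDiffOn_comp_extend_symm hf he₁
  pos _ _ := hpos _
  hasFDerivAt _ hy := g₁.hasFDerivAt_comp_extend_symm hf he₁ hy
  parallel _ hy := g₁.hasFDerivAt_gradientInChart hf hH he₁ hy

/-- Every chart in the product atlas is a product chart, and near each point of its target the
warped metric has the local form `LocalMetric.warped`; the germ determines the divergence. -/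
theorem warpedProduct_concircularDivergenceFree (g₁ : PseudoRiemannianMetric I₁ M₁)
    (g₂ : PseudoRiemannianMetric I₂ M₂) (f : M₁ → ℝ) (hf : ContMDiff I₁ 𝓘(ℝ, ℝ) ∞ f)
    (hpos : ∀ p, 0 < f p)
    (h : ∀ e₁ ∈ atlas H₁ M₁, ∀ e₂ ∈ atlas H₂ M₂,
      ∀ y ∈ (e₁.extend I₁).target ×ˢ (e₂.extend I₂).target, ∀ X Y Z,
      LocalMetric.divConcircular (LocalMetric.warped (g₁.inChart e₁) (g₂.inChart e₂)
        (f ∘ (e₁.extend I₁).symm)) y X Y Z = 0) :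
    (warpedProduct g₁ g₂ f hf hpos).ConcircularDivergenceFree := by
  rintro _ ⟨e₁, he₁, e₂, he₂, rfl⟩ y hy X Y Z
  rw [OpenPartialHomeomorph.extend_prod, PartialEquiv.prod_target] at hy
  rw [← h e₁ he₁ e₂ he₂ y hy X Y Z]
  refine LocalMetric.divConcircular_congr ?_ X Y Z
  filter_upwards [((e₁.isOpen_extend_target (I := I₁)).prod
    (e₂.isOpen_extend_target (I := I₂))).mem_nhds hy] with z hz
  exact bilinInChart_warpedForm g₁ g₂ f he₁ he₂ hz.1 hz.2

end WarpedProductCharts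

theorem mainTheorem5
    {E₁ : Type*} [NormedAddCommGroup E₁] [NormedSpace ℝ E₁] [FiniteDimensional ℝ E₁]
    {H₁ : Type*} [TopologicalSpace H₁] {I₁ : ModelWithCorners ℝ E₁ H₁} [I₁.Boundaryless]
    {M₁ : Type*} [TopologicalSpace M₁] [ChartedSpace H₁ M₁] [IsManifold I₁ ∞ M₁]
    {E₂ : Type*} [NormedAddCommGroup E₂] [NormedSpace ℝ E₂] [FiniteDimensional ℝ E₂]
    {H₂ : Type*} [TopologicalSpace H₂] {I₂ : ModelWithCorners ℝ E₂ H₂} [I₂.Boundaryless]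
    {M₂ : Type*} [TopologicalSpace M₂] [ChartedSpace H₂ M₂] [IsManifold I₂ ∞ M₂]
    (g₁ : PseudoRiemannianMetric I₁ M₁) (g₂ : PseudoRiemannianMetric I₂ M₂)
    (f : M₁ → ℝ) (hf : ContMDiff I₁ 𝓘(ℝ, ℝ) ∞ f) (hpos : ∀ p, 0 < f p)
    (hdim₁ : Module.finrank ℝ E₁ ≠ 2) :
    (Module.finrank ℝ E₂ ≠ 2 → (∃ c : ℝ, ∀ p, f p = c) →
        g₁.ConcircularDivergenceFree → g₂.ConcircularDivergenceFree →
        (warpedProduct g₁ g₂ f hf hpos).ConcircularDivergenceFree) ∧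
    (g₁.HessianEqZero f → g₁.ConcircularDivergenceFree →
        (∀ p : M₁, g₂.IsEinsteinWithFactor (g₁.val p (g₁.gradient f p) (g₁.gradient f p))) →
        (warpedProduct g₁ g₂ f hf hpos).ConcircularDivergenceFree) := by
  refine ⟨fun hdim₂ ⟨c, hc⟩ h₁ h₂ => ?_, fun hH h₁ hE => ?_⟩ <;>
    refine warpedProduct_concircularDivergenceFree g₁ g₂ f hf hpos
      fun e₁ he₁ e₂ he₂ y hy X Y Z => ?_
  · exact (isWarpingOn_inChart g₁ g₂ hf hpos
      (g₁.hessianEqZero_of_const hc) he₁ he₂).divConcircular_of_gradient_eq_zero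
      (fun y _ => g₁.vectorFieldInChart_gradient_of_const hc e₁ y) hdim₁ hdim₂ hy
      (h₁ e₁ he₁ y.1 hy.1) (h₂ e₂ he₂ y.2 hy.2) X Y Z
  · refine (isWarpingOn_inChart g₁ g₂ hf hpos hH he₁ he₂).divConcircular_of_einstein
      (fun z hz A B => ?_) hdim₁ hy (h₁ e₁ he₁ y.1 hy.1) X Y Z
    -- The Einstein factor is taken at the base point with coordinates `z.1`, so it matches the
    -- coefficient in the fibre block of Ric there.
    rw [g₁.inChart_gradient_gradient f he₁ hz.1]
    exact hE _ e₂ he₂ z.2 hz.2 A B
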